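/- A digraph $D=(V,A)$ is finite, without loops and without parallel arcs (opposite arcs $xy$ and $yx$ are allowed). It is 2-connected if its underlying undirected graph is 2-connected, i.e. has at least three vertices, is connected, and stays connected after the deletion of any one vertex. Its independence number $\alpha(D)$ is the largest number of vertices no two of which are joined by an arc. A Hamilton oriented cycle of $D$ is a cyclic sequence $x_1x_2\dots x_p$ $(p\ge 3)$ in which every vertex of $D$ occurs exactly once and such that for every $i$ (indices modulo $p$) at least one of $x_ix_{i+1}$, $x_{i+1}x_i$ is an arc of $D$. It has a forward arc at $i$ if $x_ix_{i+1}\in A$, and a backward arc at $i$ otherwise (so that $x_{i+1}x_i\in A$ and $x_ix_{i+1}\notin A$). (i) Every 2-connected digraph $D$ with $\alpha(D)\le 2$ has a Hamilton oriented cycle with at most five backward arcs. (ii) There is a 2-connected digraph $D$ with $\alpha(D)\le 2$ in which every Hamilton oriented cycle has at least four backward arcs. -/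

import Mathlib

/-- `G` is `k`-connected: it has more than `k` vertices, and it stays connected after the deletion
of any set of fewer than `k` vertices. -/
def SimpleGraph.IsKConnected {V : Type*} [Finite V] (G : SimpleGraph V) (k : ℕ) : Prop :=
  k < Nat.card V ∧ ∀ S : Set V, S.ncard < k → (G.induce Sᶜ).Connected

namespace Digraph

variable {V : Type*}

/-- No vertex has an arc to itself. -/
def IsLoopless (D : Digraph V) : Prop := ∀ v, ¬ D.Adj v v

/-- A digraph is `k`-connected if its underlying undirected graph is. (Parallel edges of the
underlying multigraph do not influence vertex connectivity.) -/
def IsKConnected [Finite V] (D : Digraph V) (k : ℕ) : Prop :=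
  D.toSimpleGraphInclusive.IsKConnected k

/-- The independence number: the maximum size of a set of vertices of which no two distinct ones
are joined by an arc in either direction. -/
noncomputable def indepNum (D : Digraph V) : ℕ := D.toSimpleGraphInclusive.indepNum

/-- The pairs of cyclically consecutive entries of the list `[x₁, …, xₚ]`, namely
`(x₁, x₂), …, (xₚ₋₁, xₚ), (xₚ, x₁)`. -/
def cyclicPairs (C : List V) : List (V × V) := C.zip (C.rotate 1)

/-- The list `[x₁, …, xₚ]` is an oriented cycle of `D`: its entries are distinct, there are at
least three, and any two cyclically consecutive ones are joined by an arc in at least one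
direction. -/
structure IsOrientedCycle (D : Digraph V) (C : List V) : Prop where
  nodup : C.Nodup
  three_le_length : 3 ≤ C.length
  adj : ∀ e ∈ cyclicPairs C, D.Adj e.1 e.2 ∨ D.Adj e.2 e.1

/-- An oriented cycle is Hamilton if it contains all vertices. -/
structure IsHamiltonOrientedCycle (D : Digraph V) (C : List V) : Prop
    extends D.IsOrientedCycle C where
  mem : ∀ v, v ∈ C

open Classical in
/-- The number of backward arcs of an oriented cycle `[x₁, …, xₚ]`: the number of indices `i`,
taken modulo `p`, such that `xᵢxᵢ₊₁` is not an arc of `D`, so that the cycle has to use the arc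
`xᵢ₊₁xᵢ` there. -/
noncomputable def backwardArcs (D : Digraph V) (C : List V) : ℕ :=
  (cyclicPairs C).countP fun e => ¬ D.Adj e.1 e.2

end Digraph

/-! Let `u` have the largest number of non-neighbours and let `K` be the set of these. As no three
vertices are independent, `K` is a clique. Outside `K`, let `Q` be the set of vertices linked to
everything else outside `K` (so `u ∈ Q`) and `N` the remainder. Maximality of `|K|` gives every
vertex of `N` a neighbour in `K`, and exactly one non-neighbour in `N` if its neighbour in `K` is
unique.

The cycle runs through a Hamilton oriented path `M` outside `K` and then through `K`; the two links
between them are charged as backward arcs. If the ends of `M` are not linked, every vertex of `K` is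
linked to one of them, and a rotated Rédei path of `K` fits with one backward arc, so `M` may have
two (`hasCycle_of_not_linked`). If the ends of `M` have distinct neighbours in `K`, then `K` is
crossed between these with two backward arcs, and `M` may have one (`hasCycle_of_ne`). Both total
five.

To find `M`, cover `N` by at most two directed paths (Gallai–Milgram). For two paths `X`, `Y`, if
the end of one is not linked to the start of the other, a path of `Q` between them gives an `M` of
the first kind. Otherwise `DPath.exists_orPath_one` merges `X`, `Y` and `Q` with one backward arc,
which suffices unless the ends share their only neighbour in `K`. Then such an end has a unique
non-neighbour `z` in `N`, and recutting the paths at `z`, with `X` as short as possible, produces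
unlinked ends again. A single path covering `N` is treated by cutting it in two. If `N` is empty,
2-connectivity supplies two suitable links between `Q` and `K`.

For the lower bound, a Hamilton cycle of `twoTournaments` uses both cross arcs, one of them
backward. One tournament is traversed from its source to its third vertex: leaving the sink costs
one. The other is traversed from its third vertex to its source: entering its first two vertices
costs two. The total of four is confirmed by exhaustive search. -/

/-- `a` and `b` are joined by an arc in at least one direction. -/
def Linked {V : Type*} (A : V → V → Prop) (a b : V) : Prop := A a b ∨ A b a

/-- The list is a directed path from `a` to `b`. -/
inductive DPath {V : Type*} (A : V → V → Prop) : V → V → List V → Prop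
  | single (a : V) : DPath A a a [a]
  | cons {a b c : V} {l : List V} : A a b → DPath A b c l → DPath A a c (a :: l)

/-- The list is an oriented path from `a` to `b` with at most `n` backward arcs. -/
inductive OrPath {V : Type*} (A : V → V → Prop) : ℕ → V → V → List V → Prop
  | single (n : ℕ) (a : V) : OrPath A n a a [a]
  | forward {n : ℕ} {a b c : V} {l : List V} :
      A a b → OrPath A n b c l → OrPath A n a c (a :: l)
  | backward {n : ℕ} {a b c : V} {l : List V} :
      A b a → OrPath A n b c l → OrPath A (n + 1) a c (a :: l)

/-! ### Calculus of directed and oriented paths; insertion and Rédei's theorem. -/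

section Paths

variable {V : Type*} {A : V → V → Prop}

theorem Linked.symm {a b : V} (h : Linked A a b) : Linked A b a := Or.symm h

theorem linked_flip {a b : V} : Linked (flip A) a b ↔ Linked A a b := or_comm

theorem DPath.orPath {a b : V} {l : List V} (h : DPath A a b l) (n : ℕ) : OrPath A n a b l := by
  induction h with
  | single a => exact .single n a
  | cons h _ ih => exact .forward h ih

theorem DPath.head {a b : V} {l : List V} (h : DPath A a b l) : ∃ l', l = a :: l' := by
  cases h <;> exact ⟨_, rfl⟩

theorem DPath.head_mem {a b : V} {l : List V} (h : DPath A a b l) : a ∈ l := by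
  cases h <;> simp

theorem DPath.last_mem {a b : V} {l : List V} (h : DPath A a b l) : b ∈ l := by
  induction h <;> simp_all

theorem OrPath.head_mem {n : ℕ} {a b : V} {l : List V} (h : OrPath A n a b l) : a ∈ l := by
  cases h <;> simp

theorem OrPath.last_mem {n : ℕ} {a b : V} {l : List V} (h : OrPath A n a b l) : b ∈ l := by
  induction h <;> simp_all

theorem DPath.append {a b c d : V} {l l' : List V} (h : DPath A a b l) (hbc : A b c)
    (h' : DPath A c d l') : DPath A a d (l ++ l') := by
  induction h with
  | single a => exact .cons hbc h'
  | cons h _ ih => exact .cons h (ih hbc)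

theorem OrPath.mono {n m : ℕ} {a b : V} {l : List V} (h : OrPath A n a b l) (hnm : n ≤ m) :
    OrPath A m a b l := by
  induction h generalizing m with
  | single n a => exact .single m a
  | forward h _ ih => exact .forward h (ih hnm)
  | backward h _ ih =>
    obtain ⟨m, rfl⟩ : ∃ k, m = k + 1 := ⟨m - 1, by omega⟩
    exact .backward h (ih (by omega))

theorem OrPath.append_of_arc {n m : ℕ} {a b c d : V} {l l' : List V} (h : OrPath A n a b l)
    (hbc : A b c) (h' : OrPath A m c d l') : OrPath A (n + m) a d (l ++ l') := by
  induction h with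
  | single n a => exact .forward hbc (h'.mono (by omega))
  | forward h _ ih => exact .forward h (ih hbc)
  | backward h _ ih => exact (OrPath.backward h (ih hbc)).mono (by omega)

/-- A joint of unknown direction is charged as one backward arc; all later budgets amount to
counting such joints. -/
theorem OrPath.append {n m : ℕ} {a b c d : V} {l l' : List V} (h : OrPath A n a b l)
    (hbc : Linked A b c) (h' : OrPath A m c d l') : OrPath A (n + m + 1) a d (l ++ l') := by
  induction h with
  | single n a =>
    rcases hbc with hbc | hbc
    · exact .forward hbc (h'.mono (by omega))
    · exact .backward hbc (h'.mono (by omega))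
  | forward h _ ih => exact .forward h (ih hbc)
  | backward h _ ih => exact (OrPath.backward h (ih hbc)).mono (by omega)

theorem DPath.reverse {a b : V} {l : List V} (h : DPath A a b l) :
    DPath (flip A) b a l.reverse := by
  induction h with
  | single a => exact .single a
  | cons h _ ih =>
    rw [List.reverse_cons]
    exact ih.append h (.single _)

theorem OrPath.reverse {n : ℕ} {a b : V} {l : List V} (h : OrPath A n a b l) :
    OrPath (flip A) n b a l.reverse := by
  induction h with
  | single n a => exact .single n a
  | @forward n a b c l h _ ih =>
    rw [List.reverse_cons]
    exact ih.append_of_arc h (.single 0 _)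
  | @backward n a b c l h _ ih =>
    rw [List.reverse_cons]
    exact ih.append (Or.inr h) (.single 0 _)

/-- A directed path splits at every inner position. -/
theorem DPath.split {a c z : V} {l₁ l₂ : List V} (h : DPath A a c (l₁ ++ z :: l₂)) :
    DPath A z c (z :: l₂) ∧ (l₁ = [] ∧ a = z ∨ ∃ b, DPath A a b l₁ ∧ A b z) := by
  induction l₁ generalizing a with
  | nil =>
    obtain ⟨l', hl'⟩ := h.head
    obtain ⟨rfl, rfl⟩ : z = a ∧ l₂ = l' := by simpa using hl'
    exact ⟨h, .inl ⟨rfl, rfl⟩⟩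
  | cons x l ih =>
    rw [List.cons_append] at h
    generalize hL : l ++ z :: l₂ = L at h
    cases h with
    | single => simp at hL
    | @cons _ b _ _ hab h =>
      subst hL
      obtain ⟨h₁, h₂⟩ := ih h
      refine ⟨h₁, .inr ?_⟩
      rcases h₂ with ⟨rfl, rfl⟩ | ⟨d, hd, hdz⟩
      · exact ⟨_, .single _, hab⟩
      · exact ⟨d, .cons hab hd, hdz⟩

theorem DPath.tail {a c : V} {l : List V} (h : DPath A a c (a :: l)) :
    l = [] ∧ a = c ∨ ∃ b, A a b ∧ DPath A b c l := by
  cases h with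
  | single => exact .inl ⟨rfl, rfl⟩
  | cons h h' => exact .inr ⟨_, h, h'⟩

/-- A vertex joined to all vertices of a directed path and dominated by one of them can be
inserted behind the start. -/
theorem DPath.exists_insert {a c t : V} {l : List V} (h : DPath A a c l)
    (ht : ∀ v ∈ l, Linked A t v) (hw : ∃ w ∈ l, A w t) :
    ∃ b l₁ l₂, l = l₁ ++ l₂ ∧ DPath A a b l₁ ∧ A b t ∧
      (l₂ = [] ∧ b = c ∨ ∃ b', A t b' ∧ DPath A b' c l₂) := by
  induction h with
  | single a => exact ⟨a, [a], [], rfl, .single a, by simpa using hw, .inl ⟨rfl, rfl⟩⟩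
  | @cons a b c l hab h ih =>
    -- Recursing while the tail still dominates `t` somewhere locates the last vertex with an arc to
    -- `t`; its successor, if any, must then be dominated by `t`.
    by_cases hl : ∃ w ∈ l, A w t
    · obtain ⟨d, l₁, l₂, rfl, h₁, h₂, h₃⟩ := ih (fun v hv => ht v (by simp [hv])) hl
      exact ⟨d, a :: l₁, l₂, rfl, .cons hab h₁, h₂, h₃⟩
    · push Not at hl
      refine ⟨a, [a], l, rfl, .single a, ?_, .inr ⟨b, ?_, h⟩⟩
      · obtain ⟨w, hw, hwt⟩ := hw
        rcases List.mem_cons.1 hw with rfl | hw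
        · exact hwt
        · exact absurd hwt (hl w hw)
      · exact (ht b (by simp [h.head_mem])).resolve_right (hl b h.head_mem)

/-- Put `t` behind the last vertex dominating it, or in front if there is none. The control of the
new ends is what later keeps them linked to the neighbouring pieces. -/
theorem DPath.insert {a c t : V} {l : List V} (h : DPath A a c l)
    (ht : ∀ v ∈ l, Linked A t v) :
    ∃ a' c' l', DPath A a' c' l' ∧ l'.Perm (t :: l) ∧ (a' = a ∨ a' = t) ∧ (c' = c ∨ c' = t) := by
  by_cases hw : ∃ w ∈ l, A w t
  · obtain ⟨b, l₁, l₂, rfl, h₁, h₂, h₃⟩ := h.exists_insert ht hw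
    rcases h₃ with ⟨rfl, rfl⟩ | ⟨b', h₃, h₄⟩
    · exact ⟨a, t, l₁ ++ [t], h₁.append h₂ (.single t), by simp,
        .inl rfl, .inr rfl⟩
    · exact ⟨a, c, l₁ ++ t :: l₂, h₁.append h₂ (.cons h₃ h₄), List.perm_middle,
        .inl rfl, .inl rfl⟩
  · push Not at hw
    exact ⟨t, c, t :: l, .cons ((ht a h.head_mem).resolve_right (hw a h.head_mem)) h, .refl _,
      .inr rfl, .inl rfl⟩

/-- Any two distinct vertices with the property are joined. -/
def LinkedOn (A : V → V → Prop) (S : V → Prop) : Prop :=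
  ∀ a b, S a → S b → a ≠ b → Linked A a b

theorem DPath.absorb {a c : V} {l T : List V} (h : DPath A a c l) (hT : T.Nodup)
    (hTT : LinkedOn A (· ∈ T)) (hTl : ∀ t ∈ T, ∀ v ∈ l, Linked A t v) :
    ∃ a' c' l', DPath A a' c' l' ∧ l'.Perm (T ++ l) ∧ (a' = a ∨ a' ∈ T) ∧ (c' = c ∨ c' ∈ T) := by
  induction T with
  | nil => exact ⟨a, c, l, h, .refl _, .inl rfl, .inl rfl⟩
  | cons t T ih =>
    obtain ⟨a₁, c₁, l₁, h₁, p₁, ha, hc⟩ := ih hT.of_cons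
      (fun x y hx hy => hTT x y (by simp [hx]) (by simp [hy]))
      (fun x hx => hTl x (by simp [hx]))
    obtain ⟨a₂, c₂, l₂, h₂, p₂, ha₂, hc₂⟩ := h₁.insert (t := t) (fun v hv => by
      rcases List.mem_append.1 (p₁.mem_iff.1 hv) with hv | hv
      · refine hTT t v (by simp) (by simp [hv]) ?_
        rintro rfl
        exact (List.nodup_cons.1 hT).1 hv
      · exact hTl t (by simp) v hv)
    refine ⟨a₂, c₂, l₂, h₂, p₂.trans (p₁.cons t), ?_, ?_⟩
    · rcases ha₂ with rfl | rfl
      · rcases ha with rfl | ha <;> simp [*]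
      · simp
    · rcases hc₂ with rfl | rfl
      · rcases hc with rfl | hc <;> simp [*]
      · simp

/-- Rédei's theorem. -/
theorem exists_dPath_of_linkedOn {T : List V} (hne : T ≠ []) (hT : T.Nodup)
    (hTT : LinkedOn A (· ∈ T)) : ∃ a c l, DPath A a c l ∧ l.Perm T := by
  obtain ⟨t, T, rfl⟩ := List.exists_cons_of_ne_nil hne
  obtain ⟨a, c, l, h, p, -⟩ := (DPath.single (A := A) t).absorb hT.of_cons
    (fun x y hx hy => hTT x y (by simp [hx]) (by simp [hy]))
    (fun x hx v hv => hTT x v (by simp [hx]) (by simp_all) (by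
      rintro rfl
      obtain rfl : x = t := by simpa using hv
      exact (List.nodup_cons.1 hT).1 hx))
  exact ⟨a, c, l, h, p.trans (List.perm_append_singleton t T)⟩

end Paths

/-! ### Covers by two directed paths. -/

/-- `L` is covered by two disjoint directed paths with the given starts. -/
def TwoPaths {V : Type*} (A : V → V → Prop) (a b : V) (L : List V) : Prop :=
  ∃ c l d m, DPath A a c l ∧ DPath A b d m ∧ (l ++ m).Perm L

/-- Among any three distinct vertices, two are linked. -/
def NoIndepTriple {V : Type*} (A : V → V → Prop) : Prop :=
  ∀ a b c : V, a ≠ b → a ≠ c → b ≠ c → Linked A a b ∨ Linked A a c ∨ Linked A b c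

section Cover

variable {V : Type*} {A : V → V → Prop}

theorem NoIndepTriple.flip (h : NoIndepTriple A) : NoIndepTriple (flip A) := by
  intro a b c hab hac hbc
  simpa only [linked_flip] using h a b c hab hac hbc

theorem TwoPaths.swap {a b : V} {L : List V} (h : TwoPaths A a b L) : TwoPaths A b a L := by
  obtain ⟨c, l, d, m, h₁, h₂, p⟩ := h
  exact ⟨d, m, c, l, h₂, h₁, List.perm_append_comm.trans p⟩

theorem TwoPaths.perm {a b : V} {L L' : List V} (h : TwoPaths A a b L) (p : L.Perm L') :
    TwoPaths A a b L' := by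
  obtain ⟨c, l, d, m, h₁, h₂, q⟩ := h
  exact ⟨c, l, d, m, h₁, h₂, q.trans p⟩

theorem TwoPaths.cons {x a b : V} {L : List V} (hx : A x a) (h : TwoPaths A a b L) :
    TwoPaths A x b (x :: L) := by
  obtain ⟨c, l, d, m, h₁, h₂, q⟩ := h
  exact ⟨c, x :: l, d, m, .cons hx h₁, h₂, q.cons x⟩

/-- The reduction step of the Gallai–Milgram theorem for independence number two. -/
theorem NoIndepTriple.twoPaths_of_three (hα : NoIndepTriple A) {a₁ a₂ a₃ c₁ c₂ c₃ : V}
    {l₁ l₂ l₃ : List V} (h₁ : DPath A a₁ c₁ l₁) (h₂ : DPath A a₂ c₂ l₂) (h₃ : DPath A a₃ c₃ l₃)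
    (hnd : (l₁ ++ l₂ ++ l₃).Nodup) :
    TwoPaths A a₁ a₂ (l₁ ++ l₂ ++ l₃) ∨ TwoPaths A a₁ a₃ (l₁ ++ l₂ ++ l₃) ∨
      TwoPaths A a₂ a₃ (l₁ ++ l₂ ++ l₃) := by
  induction hn : (l₁ ++ l₂ ++ l₃).length using Nat.strong_induction_on
    generalizing a₁ a₂ a₃ c₁ c₂ c₃ l₁ l₂ l₃ with
  | _ n ih =>
  -- Given the arc from `a₁` to `a₂`, delete `a₁` and recurse. Of the three remaining starts, two
  -- survive, so the successor of `a₁` or `a₂` is among them, and `a₁` can be put in front of it.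
  have core : ∀ {a₁ a₂ a₃ c₁ c₂ c₃ : V} {m₁ m₂ m₃ : List V}, DPath A a₁ c₁ m₁ →
      DPath A a₂ c₂ m₂ → DPath A a₃ c₃ m₃ → (m₁ ++ m₂ ++ m₃).Perm (l₁ ++ l₂ ++ l₃) → A a₁ a₂ →
      TwoPaths A a₁ a₂ (l₁ ++ l₂ ++ l₃) ∨ TwoPaths A a₁ a₃ (l₁ ++ l₂ ++ l₃) := by
    intro a₁ a₂ a₃ c₁ c₂ c₃ m₁ m₂ m₃ h₁ h₂ h₃ p h₁₂
    obtain ⟨t, rfl⟩ := h₁.head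
    rcases h₁.tail with ⟨rfl, rfl⟩ | ⟨b, hab, hb⟩
    · exact .inr ⟨_, _, _, _, .cons h₁₂ h₂, h₃, by simpa using p⟩
    · have hnd' := p.nodup_iff.2 hnd
      have hlen := p.length_eq
      rcases ih (t ++ m₂ ++ m₃).length (by simp at hlen hn ⊢; omega) hb h₂ h₃
        (by simpa using hnd'.of_cons) rfl with h | h | h
      · exact .inl ((h.cons hab).perm (by simpa using p))
      · exact .inr ((h.cons hab).perm (by simpa using p))
      · exact .inr ((h.cons h₁₂).perm (by simpa using p))
  have hne : a₁ ≠ a₂ ∧ a₁ ≠ a₃ ∧ a₂ ≠ a₃ := by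
    obtain ⟨t₁, rfl⟩ := h₁.head
    obtain ⟨t₂, rfl⟩ := h₂.head
    obtain ⟨t₃, rfl⟩ := h₃.head
    simp [List.nodup_append] at hnd
    refine ⟨?_, ?_, ?_⟩ <;> rintro rfl <;> simp_all
  classical
  rcases hα a₁ a₂ a₃ hne.1 hne.2.1 hne.2.2 with (h | h) | (h | h) | (h | h)
  · exact (core h₁ h₂ h₃ (.refl _) h).imp id .inl
  · rcases core h₂ h₁ h₃ (by
      rw [List.perm_iff_count]; intro; simp only [List.count_append]; omega) h with h | h
    · exact .inl h.swap
    · exact .inr (.inr h)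
  · rcases core h₁ h₃ h₂ (by
      rw [List.perm_iff_count]; intro; simp only [List.count_append]; omega) h with h | h
    · exact .inr (.inl h)
    · exact .inl h
  · rcases core h₃ h₁ h₂ (by
      rw [List.perm_iff_count]; intro; simp only [List.count_append]; omega) h with h | h
    · exact .inr (.inl h.swap)
    · exact .inr (.inr h.swap)
  · rcases core h₂ h₃ h₁ (by
      rw [List.perm_iff_count]; intro; simp only [List.count_append]; omega) h with h | h
    · exact .inr (.inr h)
    · exact .inl h.swap
  · rcases core h₃ h₂ h₁ (by
      rw [List.perm_iff_count]; intro; simp only [List.count_append]; omega) h with h | h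
    · exact .inr (.inr h.swap)
    · exact .inr (.inl h.swap)

/-- The Gallai–Milgram theorem for independence number two. -/
theorem NoIndepTriple.exists_cover (hα : NoIndepTriple A) {S : List V} (hS : S.Nodup) :
    S = [] ∨ (∃ a c l, DPath A a c l ∧ l.Perm S) ∨ ∃ a b, TwoPaths A a b S := by
  induction S with
  | nil => exact .inl rfl
  | cons v S ih =>
    right
    rcases ih hS.of_cons with rfl | ⟨a, c, l, h, p⟩ | ⟨a, b, c, l, d, m, h₁, h₂, p⟩
    · exact .inl ⟨v, v, [v], .single v, .refl _⟩
    · exact .inr ⟨v, a, v, [v], c, l, .single v, h, by simpa using p⟩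
    · have p' : ([v] ++ l ++ m).Perm (v :: S) := by simpa using p
      rcases hα.twoPaths_of_three (.single v) h₁ h₂ (p'.nodup_iff.2 hS) with h | h | h
      · exact .inr ⟨_, _, h.perm p'⟩
      · exact .inr ⟨_, _, h.perm p'⟩
      · exact .inr ⟨_, _, h.perm p'⟩

end Cover

/-! ### Merging two directed paths and a universal clique with one backward arc. -/

section Merge

variable {V : Type*} {A : V → V → Prop}

/-- Vertices of a pool of universal vertices are inserted behind the start of a directed path as
long as possible; the remaining ones dominate the path. Inserted vertices behind the old end are
recorded separately. -/
theorem DPath.exists_maximal_insert {a e c : V} {X T L : List V} (hX : DPath A a e X)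
    (h : DPath A a c (X ++ T)) (hL : L.Nodup)
    (hlink : ∀ t ∈ L, ∀ v, v ∈ X ∨ v ∈ T ∨ v ∈ L → t ≠ v → Linked A t v)
    (hdisj : ∀ t ∈ L, t ∉ X ∧ t ∉ T) :
    ∃ c' X' T' L', DPath A a e X' ∧ DPath A a c' (X' ++ T') ∧
      (X' ++ T' ++ L').Perm (X ++ T ++ L) ∧ (∀ v ∈ T', v ∈ T ∨ v ∈ L) ∧ (∀ v ∈ L', v ∈ L) ∧
      ∀ t ∈ L', ∀ w ∈ X' ++ T', A t w := by
  classical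
  induction hn : L.length generalizing c X T L with
  | zero =>
    obtain rfl := List.length_eq_zero_iff.1 hn
    exact ⟨c, X, T, [], hX, h, .refl _, fun v hv => .inl hv, by simp, by simp⟩
  | succ n ih =>
    by_cases hdom : ∀ t ∈ L, ∀ w ∈ X ++ T, ¬ A w t
    · refine ⟨c, X, T, L, hX, h, .refl _, fun v hv => .inl hv, fun v hv => hv, ?_⟩
      intro t ht w hw
      refine (hlink t ht w ?_ ?_).resolve_right (hdom t ht w hw)
      · simp at hw; tauto
      · rintro rfl
        have := hdisj t ht
        simp at hw; tauto
    · push Not at hdom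
      obtain ⟨t, ht, w, hw, hwt⟩ := hdom
      have htl : ∀ v ∈ X ++ T, Linked A t v := by
        intro v hv
        have hd := hdisj t ht
        refine hlink t ht v ?_ ?_
        · simp at hv; tauto
        · rintro rfl
          simp at hv; tauto
      have pL : (t :: L.erase t).Perm L := (List.perm_cons_erase ht).symm
      have key : ∀ c' X' T', DPath A a e X' → DPath A a c' (X' ++ T') →
          (X' ++ T').Perm (t :: (X ++ T)) → (∀ v ∈ T', v ∈ T ∨ v = t) →
          ∃ c' X' T' L', DPath A a e X' ∧ DPath A a c' (X' ++ T') ∧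
      (X' ++ T' ++ L').Perm (X ++ T ++ L) ∧ (∀ v ∈ T', v ∈ T ∨ v ∈ L) ∧ (∀ v ∈ L', v ∈ L) ∧
      ∀ t ∈ L', ∀ w ∈ X' ++ T', A t w := by
        intro c' X' T' hX' h' p' hT'
        have hmem : ∀ v, v ∈ X' ∨ v ∈ T' ↔ v = t ∨ v ∈ X ∨ v ∈ T := by
          intro v; simpa using p'.mem_iff (a := v)
        obtain ⟨c₂, X₂, T₂, L₂, h₁, h₂, p₂, h₃, h₄, h₅⟩ := ih hX' h' (hL.erase t)
          (by
            intro s hs v hv hsv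
            have hsL := List.mem_of_mem_erase hs
            have : v ∈ X ∨ v ∈ T ∨ v ∈ L := by
              rcases hv with hv | hv | hv
              · rcases (hmem v).1 (.inl hv) with rfl | h | h <;> tauto
              · rcases (hmem v).1 (.inr hv) with rfl | h | h <;> tauto
              · exact .inr (.inr (List.mem_of_mem_erase hv))
            exact hlink s hsL v this hsv)
          (by
            intro s hs
            have hsL := List.mem_of_mem_erase hs
            have hst : s ≠ t := by
              rintro rfl
              exact hL.not_mem_erase hs
            have := hdisj s hsL
            have := hmem s
            tauto)
          (by rw [List.length_erase_of_mem ht]; omega)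
        refine ⟨c₂, X₂, T₂, L₂, h₁, h₂, ?_, ?_, fun v hv => List.mem_of_mem_erase (h₄ v hv), h₅⟩
        · refine p₂.trans ?_
          rw [List.perm_iff_count] at p' pL ⊢
          intro x
          have := p' x
          have := pL x
          simp only [List.count_append, List.count_cons] at *
          omega
        · intro v hv
          rcases h₃ v hv with hv | hv
          · rcases hT' v hv with hv | rfl
            · exact .inl hv
            · exact .inr ht
          · exact .inr (List.mem_of_mem_erase hv)
      obtain ⟨b, l₁, l₂, hl, h₁, h₂, h₃⟩ := h.exists_insert htl ⟨w, hw, hwt⟩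
      obtain ⟨c', hc'⟩ : ∃ c', DPath A a c' (l₁ ++ t :: l₂) := by
        rcases h₃ with ⟨rfl, -⟩ | ⟨b', h₃, h₄⟩
        · exact ⟨t, h₁.append h₂ (.single t)⟩
        · exact ⟨c, h₁.append h₂ (.cons h₃ h₄)⟩
      have pl : (l₁ ++ t :: l₂).Perm (t :: (X ++ T)) := by
        rw [hl]; exact List.perm_middle
      -- A vertex inserted strictly inside `X` keeps its end `e`; one inserted directly behind `e`
      -- or later belongs to `T`.
      rcases List.append_eq_append_iff.1 hl with ⟨m, rfl, rfl⟩ | ⟨m, rfl, rfl⟩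
      · refine key c' X (m ++ t :: l₂) hX (by simpa using hc') (by simpa using pl) ?_
        intro v hv
        simp at hv ⊢
        tauto
      · cases m with
        | nil =>
          simp only [List.append_nil, List.nil_append] at *
          refine key c' l₁ (t :: T) hX hc' pl ?_
          intro v hv
          simp at hv
          tauto
        | cons w m =>
          rcases h₃ with ⟨h, -⟩ | ⟨b', h₃, h₄⟩
          · simp at h
          · obtain ⟨m', hm'⟩ := h₄.head
            obtain rfl : w = b' := (List.cons.inj hm').1
            refine key c' (l₁ ++ t :: w :: m) T (h₁.append h₂ (.cons h₃ hX.split.1))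
              (by simpa using hc') (by simp) (fun v hv => .inl hv)

theorem DPath.getLast? {a b : V} {l : List V} (h : DPath A a b l) : l.getLast? = some b := by
  induction h with
  | single => rfl
  | @cons a b c l _ h ih =>
    obtain ⟨m, rfl⟩ := h.head
    rwa [List.getLast?_cons_cons]

/-- Put `t` in front of the first vertex it dominates; the predecessor, not being dominated by `t`,
dominates it. Hence the end is never displaced. -/
theorem DPath.insert_keep_end {a c t : V} {l : List V} (h : DPath A a c l)
    (ht : ∀ v ∈ l, Linked A t v) (hw : ∃ w ∈ l, A t w) :
    ∃ a' l', DPath A a' c l' ∧ l'.Perm (t :: l) ∧ (a' = a ∨ a' = t) := by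
  induction h with
  | single a => exact ⟨t, [t, a], .cons (by simpa using hw) (.single a), .refl _, .inr rfl⟩
  | @cons a b c l hab h ih =>
    by_cases hta : A t a
    · exact ⟨t, _, .cons hta (.cons hab h), .refl _, .inr rfl⟩
    · obtain ⟨a', l', h', p', ha'⟩ := ih (fun v hv => ht v (by simp [hv])) (by
        obtain ⟨w, hw, htw⟩ := hw
        rcases List.mem_cons.1 hw with rfl | hw
        · exact absurd htw hta
        · exact ⟨w, hw, htw⟩)
      refine ⟨a, a :: l', .cons ?_ h', (p'.cons a).trans (List.Perm.swap _ _ _), .inl rfl⟩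
      rcases ha' with rfl | rfl
      · exact hab
      · exact (ht a (by simp)).resolve_left hta

theorem DPath.absorb_keep_end {a c : V} {l T : List V} (h : DPath A a c l) (hT : T.Nodup)
    (hTT : LinkedOn A (· ∈ T)) (hTl : ∀ t ∈ T, ∀ v ∈ l, Linked A t v)
    (hw : ∀ t ∈ T, ∃ w ∈ l, A t w) :
    ∃ a' l', DPath A a' c l' ∧ l'.Perm (T ++ l) ∧ (a' = a ∨ a' ∈ T) := by
  induction T with
  | nil => exact ⟨a, l, h, .refl _, .inl rfl⟩
  | cons t T ih =>
    obtain ⟨a₁, l₁, h₁, p₁, ha⟩ := ih hT.of_cons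
      (fun x y hx hy => hTT x y (by simp [hx]) (by simp [hy]))
      (fun x hx => hTl x (by simp [hx])) (fun x hx => hw x (by simp [hx]))
    obtain ⟨a₂, l₂, h₂, p₂, ha₂⟩ := h₁.insert_keep_end (t := t) (fun v hv => by
      rcases List.mem_append.1 (p₁.mem_iff.1 hv) with hv | hv
      · refine hTT t v (by simp) (by simp [hv]) ?_
        rintro rfl
        exact (List.nodup_cons.1 hT).1 hv
      · exact hTl t (by simp) v hv) (by
      obtain ⟨w, hw, htw⟩ := hw t (by simp)
      exact ⟨w, p₁.mem_iff.2 (by simp [hw]), htw⟩)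
    refine ⟨a₂, l₂, h₂, p₂.trans (p₁.cons t), ?_⟩
    rcases ha₂ with rfl | rfl
    · rcases ha with rfl | ha <;> simp [*]
    · simp

/-- Two directed paths that can be closed to a cycle, together with a clique of vertices linked to
all others, form an oriented path with at most one backward arc which starts like one of the paths
and ends like the other one. -/
theorem DPath.exists_orPath_one {x x' y y' : V} {X Y T : List V} (hX : DPath A x x' X)
    (hY : DPath A y y' Y) (hnd : (X ++ Y ++ T).Nodup) (hTT : LinkedOn A (· ∈ T))
    (hTX : ∀ t ∈ T, ∀ v ∈ X, Linked A t v) (hTY : ∀ t ∈ T, ∀ v ∈ Y, Linked A t v)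
    (hxy : Linked A x' y) :
    ∃ l, l.Perm (X ++ Y ++ T) ∧ (OrPath A 1 x y' l ∨ OrPath A 1 y x' l) := by
  classical
  simp only [List.nodup_append, List.mem_append] at hnd
  obtain ⟨⟨hXn, hYn, hXY⟩, hTn, hdT⟩ := hnd
  obtain ⟨c, X', T', L, hX', hXT, p, hT', hL, hdom⟩ := hX.exists_maximal_insert (T := []) (L := T)
    (by simpa using hX) hTn (by
      rintro t ht v (hv | hv | hv) htv
      · exact hTX t ht v hv
      · simp at hv
      · exact hTT t v ht hv htv) (by
      intro t ht
      refine ⟨fun h => hdT t (.inl h) t ht rfl, by simp⟩)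
  simp only [List.append_nil, List.not_mem_nil, false_or] at p hT'
  have hnd' : (X' ++ T' ++ L).Nodup := p.nodup_iff.2 (by
    simp only [List.nodup_append]
    exact ⟨hXn, hTn, fun a ha b hb => hdT a (.inl ha) b hb⟩)
  simp only [List.nodup_append, List.mem_append] at hnd'
  obtain ⟨⟨hX'n, hT'n, -⟩, hLn, hXL⟩ := hnd'
  have hc : c = x' ∧ T' = [] ∨ c ∈ T' := by
    have h₁ := hX'.getLast?
    have h₂ := hXT.getLast?
    cases hT'' : T'.getLast? with
    | none =>
      obtain rfl := List.getLast?_eq_none_iff.1 hT''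
      simp_all
    | some d =>
      rw [List.getLast?_append, hT''] at h₂
      obtain rfl : d = c := by simpa using h₂
      exact .inr (List.mem_of_getLast? hT'')
  -- If every leftover vertex dominates some vertex of `Y`, all of them go into `Y` without changing
  -- its end, and the only joint is the one from the enlarged `X` to the enlarged `Y`.
  by_cases h0 : ∀ t ∈ L, ∃ w ∈ Y, A t w
  · obtain ⟨a, Y', hY', pY, ha⟩ := hY.absorb_keep_end hLn
      (fun s t hs ht => hTT s t (hL s hs) (hL t ht)) (fun t ht => hTY t (hL t ht)) h0
    refine ⟨(X' ++ T') ++ Y', ?_, .inl ?_⟩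
    · rw [List.perm_iff_count] at p pY ⊢
      intro v
      have := p v
      have := pY v
      simp only [List.count_append] at *
      omega
    · refine OrPath.append (n := 0) (m := 0) (hXT.orPath 0) ?_ (hY'.orPath 0)
      rcases hc with ⟨rfl, -⟩ | hc
      · rcases ha with rfl | ha
        · exact hxy
        · exact (hTX a (hL a ha) c hX.last_mem).symm
      · rcases ha with rfl | ha
        · exact hTY c (hT' c hc) a hY.head_mem
        · exact hTT c a (hT' c hc) (hL a ha) (hXL c (.inr hc) a ha)
  · push Not at h0
    obtain ⟨t₀, ht₀, ht₀Y⟩ := h0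
    -- Leftover vertices dominating nothing in `Y` are dominated by all of `Y` and form a path `R`
    -- behind it. Every leftover vertex dominates `X' ++ T'`, so `R` continues into `T'`, and the
    -- other leftovers go in front of `X'`. The only joint is then between `Y ++ R ++ T'` and `S`,
    -- which ends in `x'`.
    let P : V → Bool := fun t => decide (∀ w ∈ Y, ¬ A t w)
    have pL : (L.filter P ++ L.filter (fun t => !P t)).Perm L := List.filter_append_perm P L
    obtain ⟨p₀, q₀, R, hR, pR⟩ := exists_dPath_of_linkedOn (A := A) (T := L.filter P)
      (List.ne_nil_of_mem (List.mem_filter.2 ⟨ht₀, by simpa [P] using ht₀Y⟩)) (hLn.filter _)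
      (fun s t hs ht => hTT s t (hL s (List.mem_of_mem_filter hs))
        (hL t (List.mem_of_mem_filter ht)))
    have hRL : ∀ v ∈ R, v ∈ L ∧ ∀ w ∈ Y, ¬ A v w := by
      intro v hv
      simpa [P] using List.mem_filter.1 (pR.mem_iff.1 hv)
    have hRT : ∀ v ∈ R, v ∈ T := fun v hv => hL v (hRL v hv).1
    have hYR : DPath A y q₀ (Y ++ R) := hY.append
      ((hTY p₀ (hRT p₀ hR.head_mem) y' hY.last_mem).resolve_left
        ((hRL p₀ hR.head_mem).2 y' hY.last_mem)) hR
    obtain ⟨d, hYRT, hdT', hdmem⟩ : ∃ d, DPath A y d (Y ++ R ++ T') ∧ d ∈ T ∧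
        (d ∈ R ∨ d ∈ T') := by
      cases hTT' : T' with
      | nil => exact ⟨q₀, by simpa using hYR, hRT q₀ hR.last_mem, .inl hR.last_mem⟩
      | cons b m =>
        rw [hTT'] at hXT
        have hcT : c ∈ b :: m := hXT.split.1.last_mem
        exact ⟨c, hYR.append (hdom q₀ (hRL q₀ hR.last_mem).1 b (by simp [hTT'])) hXT.split.1,
          hT' c (hTT' ▸ hcT), .inr hcT⟩
    obtain ⟨e, S, hS, pS, he⟩ : ∃ e S, DPath A e x' S ∧
        S.Perm (L.filter (fun t => !P t) ++ X') ∧ (e = x ∨ e ∈ L.filter (fun t => !P t)) := by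
      by_cases hnil : L.filter (fun t => !P t) = []
      · exact ⟨x, X', hX', by simp [hnil], .inl rfl⟩
      · obtain ⟨p₁, q₁, S, hS, pS⟩ := exists_dPath_of_linkedOn (A := A) hnil (hLn.filter _)
          (fun s t hs ht => hTT s t (hL s (List.mem_of_mem_filter hs))
            (hL t (List.mem_of_mem_filter ht)))
        refine ⟨p₁, S ++ X', hS.append (hdom q₁ (List.mem_of_mem_filter
          (pS.mem_iff.1 hS.last_mem)) x (by simp [hX'.head_mem])) hX', pS.append_right X',
          .inr (pS.mem_iff.1 hS.head_mem)⟩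
    refine ⟨(Y ++ R ++ T') ++ S, ?_, .inr ?_⟩
    · rw [List.perm_iff_count] at p pL pR pS ⊢
      intro v
      have := p v
      have := pL v
      have := pR v
      have := pS v
      simp only [List.count_append] at *
      omega
    · refine OrPath.append (n := 0) (m := 0) (hYRT.orPath 0) ?_ (hS.orPath 0)
      rcases he with rfl | he
      · exact hTX d hdT' e hX.head_mem
      · refine hTT d e hdT' (hL e (List.mem_of_mem_filter he)) ?_
        rintro rfl
        rcases hdmem with hd | hd
        · have h₁ := (List.mem_filter.1 (pR.mem_iff.1 hd)).2
          have h₂ := (List.mem_filter.1 he).2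
          simp [h₁] at h₂
        · exact hXL d (.inr hd) d (List.mem_of_mem_filter he) rfl

end Merge

/-! ### Closing a path outside a clique to a Hamilton cycle. -/

/-- There is a Hamilton oriented cycle with at most five backward arcs, given as a Hamilton oriented
path with at most four backward arcs between linked vertices. -/
def HasCycle {V : Type*} (A : V → V → Prop) : Prop :=
  ∃ a b L, OrPath A 4 a b L ∧ Linked A b a ∧ L.Nodup ∧ ∀ v, v ∈ L

section Closing

variable {V : Type*} {A : V → V → Prop}

theorem HasCycle.of_flip (h : HasCycle (flip A)) : HasCycle A := by
  obtain ⟨a, b, L, h, hba, hnd, hL⟩ := h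
  exact ⟨b, a, L.reverse, h.reverse, hba, List.nodup_reverse.2 hnd, by simpa using hL⟩

theorem DPath.exists_split_or {a c : V} {l : List V} (h : DPath A a c l) {P : V → Prop}
    (ha : P a) : (∀ v ∈ l, P v) ∨ ∃ b b' l₁ l₂, l = l₁ ++ l₂ ∧ DPath A a b l₁ ∧
      DPath A b' c l₂ ∧ A b b' ∧ P b ∧ ¬ P b' := by
  induction h with
  | single a => exact .inl (by simpa using ha)
  | @cons a b c l hab h ih =>
    by_cases hb : P b
    · rcases ih hb with ih | ⟨d, d', l₁, l₂, rfl, h₁, h₂, h₃⟩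
      · exact .inl (by simpa using ⟨ha, ih⟩)
      · exact .inr ⟨d, d', a :: l₁, l₂, rfl, .cons hab h₁, h₂, h₃⟩
    · exact .inr ⟨a, b, [a], l, rfl, .single a, h, hab, ha, hb⟩

/-- If some vertex in `S` is followed by one in `E`, cut there and join the old end to the old
start. Otherwise `S` propagates forwards to the last vertex and `E` backwards to the first, and the
path itself will do. -/
theorem DPath.exists_rotation {a c : V} {l : List V} (h : DPath A a c l) (hl : l.Nodup)
    (hll : LinkedOn A (· ∈ l)) {S E : V → Prop} (hSE : ∀ v ∈ l, S v ∨ E v) (hS : ∃ v ∈ l, S v)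
    (hE : ∃ v ∈ l, E v) : ∃ e s l', OrPath A 1 e s l' ∧ l'.Perm l ∧ E e ∧ S s := by
  have key : (∃ b b' l₁ l₂, l = l₁ ++ l₂ ∧ DPath A a b l₁ ∧ DPath A b' c l₂ ∧ S b ∧ E b') ∨
      (S c ∨ ∀ v ∈ l, ¬ S v) ∧ (E a ∨ ∀ v ∈ l, ¬ E v) := by
    clear hl hll hS hE
    induction h with
    | single a => right; simp; tauto
    | @cons a b c l hab h ih =>
      rcases ih (fun v hv => hSE v (by simp [hv])) with
        ⟨d, d', l₁, l₂, rfl, h₁, h₂, h₃⟩ | ⟨hc, hb⟩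
      · exact .inl ⟨d, d', a :: l₁, l₂, rfl, .cons hab h₁, h₂, h₃⟩
      · by_cases hs : S a ∧ E b
        · exact .inl ⟨a, b, [a], l, rfl, .single a, h, hs⟩
        · right
          have h₁ := hSE a (by simp)
          have h₂ := hSE b (by simp [h.head_mem])
          constructor
          · rcases hc with hc | hc
            · exact .inl hc
            · have := hc b h.head_mem
              exact .inr (by simp; tauto)
          · rcases hb with hb | hb
            · by_cases ha : E a
              · exact .inl ha
              · tauto
            · by_cases ha : E a
              · exact .inl ha
              · exact .inr (by simp; tauto)
  rcases key with ⟨b, b', l₁, l₂, rfl, h₁, h₂, hb, hb'⟩ | ⟨h₁, h₂⟩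
  · refine ⟨b', b, l₂ ++ l₁, OrPath.append (n := 0) (m := 0) (h₂.orPath 0) ?_ (h₁.orPath 0),
      List.perm_append_comm, hb', hb⟩
    refine hll c a (by simp [h₂.last_mem]) (by simp [h₁.head_mem]) ?_
    rintro rfl
    exact (List.nodup_append.1 hl).2.2 c h₁.head_mem c h₂.last_mem rfl
  · obtain ⟨v, hv, hSv⟩ := hS
    obtain ⟨w, hw, hEw⟩ := hE
    exact ⟨a, c, l, h.orPath 1, .refl l, h₂.resolve_right (fun h => h w hw hEw),
      h₁.resolve_right (fun h => h v hv hSv)⟩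

/-- Every vertex of `K` is linked to `s` or to `e`, so `DPath.exists_rotation` applies to a Rédei
path of `K`. Budget before closing: two for `M`, one for the link, one for the rotation. -/
theorem hasCycle_of_not_linked (hα : NoIndepTriple A) {K : Finset V}
    (hKK : LinkedOn A (· ∈ K)) {M : List V} {s e : V} (hM : OrPath A 2 s e M) (hnd : M.Nodup)
    (hMK : ∀ v, v ∈ M ↔ v ∉ K) (hse : s ≠ e) (hns : ¬ Linked A s e)
    (hs : ∃ k ∈ K, Linked A s k) (he : ∃ k ∈ K, Linked A e k) : HasCycle A := by
  obtain ⟨k, hk, hsk⟩ := hs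
  obtain ⟨k', hk', hek⟩ := he
  have hsK : s ∉ K := (hMK s).1 hM.head_mem
  have heK : e ∉ K := (hMK e).1 hM.last_mem
  obtain ⟨a, c, l, hl, p⟩ := exists_dPath_of_linkedOn (A := A) (T := K.toList)
    (List.ne_nil_of_mem (Finset.mem_toList.2 hk)) K.nodup_toList
    (by simpa only [Finset.mem_toList] using hKK)
  have hlK : ∀ v, v ∈ l ↔ v ∈ K := fun v => by rw [p.mem_iff, Finset.mem_toList]
  obtain ⟨f, t, l', hl', p', hf, ht⟩ := hl.exists_rotation (p.nodup_iff.2 K.nodup_toList)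
    (by simpa only [hlK] using hKK) (S := fun v => Linked A v s) (E := fun v => Linked A e v)
    (by
      intro v hv
      have hv' := (hlK v).1 hv
      rcases hα v s e (by rintro rfl; exact hsK hv') (by rintro rfl; exact heK hv') hse with
        h | h | h
      · exact .inl h
      · exact .inr h.symm
      · exact absurd h hns)
    ⟨k, (hlK k).2 hk, hsk.symm⟩ ⟨k', (hlK k').2 hk', hek⟩
  have hlK' : ∀ v, v ∈ l' ↔ v ∈ K := fun v => by rw [p'.mem_iff, hlK]
  refine ⟨s, t, M ++ l', hM.append hf hl', ht, ?_, ?_⟩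
  · refine List.nodup_append.2 ⟨hnd, (p'.trans p).nodup_iff.2 K.nodup_toList, ?_⟩
    rintro a ha b hb rfl
    exact (hMK a).1 ha ((hlK' a).1 hb)
  · intro v
    rw [List.mem_append, hMK, hlK']
    tauto

/-- Between `k` and `k'` run a Rédei path of the rest of `K`, with two joints. Budget before
closing: one for `M`, one for the link, two inside `K`. -/
theorem hasCycle_of_ne {K : Finset V}
    (hKK : LinkedOn A (· ∈ K)) {M : List V} {s e : V} (hM : OrPath A 1 s e M) (hnd : M.Nodup)
    (hMK : ∀ v, v ∈ M ↔ v ∉ K) {k k' : V} (hk : k ∈ K) (hk' : k' ∈ K) (hek : Linked A e k)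
    (hsk : Linked A k' s) (hkk' : k ≠ k' ∨ ∀ κ ∈ K, κ = k) : HasCycle A := by
  classical
  suffices ∃ l, OrPath A 2 k k' l ∧ l.Nodup ∧ ∀ v, v ∈ l ↔ v ∈ K by
    obtain ⟨l, hl, hln, hlK⟩ := this
    refine ⟨s, k', M ++ l, hM.append hek hl, hsk, ?_, ?_⟩
    · refine List.nodup_append.2 ⟨hnd, hln, ?_⟩
      rintro a ha b hb rfl
      exact (hMK a).1 ha ((hlK a).1 hb)
    · intro v
      rw [List.mem_append, hMK, hlK]
      tauto
  by_cases hone : ∀ κ ∈ K, κ = k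
  · obtain rfl := hone k' hk'
    refine ⟨[k'], .single 2 k', by simp, fun v => ?_⟩
    rw [List.mem_singleton]
    exact ⟨fun h => h ▸ hk, fun h => hone v h⟩
  have hne := hkk'.resolve_right hone
  by_cases hnil : ((K.erase k).erase k').toList = []
  · refine ⟨[k] ++ [k'], (OrPath.append (.single 0 k) (hKK k k' hk hk' hne) (.single 0 k')).mono
      (by omega), by simpa using hne, fun v => ?_⟩
    have h := Finset.toList_eq_nil.1 hnil
    have hv : v ∉ (K.erase k).erase k' := by simp [h]
    simp only [Finset.mem_erase] at hv
    simp only [List.cons_append, List.nil_append, List.mem_cons, List.not_mem_nil, or_false]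
    constructor
    · rintro (rfl | rfl) <;> assumption
    · tauto
  · obtain ⟨a, c, l, hl, p⟩ := exists_dPath_of_linkedOn (A := A) hnil (Finset.nodup_toList _) (by
      intro a b ha hb hab
      simp only [Finset.mem_toList, Finset.mem_erase] at ha hb
      exact hKK a b ha.2.2 hb.2.2 hab)
    have hlK : ∀ v, v ∈ l ↔ v ≠ k' ∧ v ≠ k ∧ v ∈ K := fun v => by
      rw [p.mem_iff, Finset.mem_toList, Finset.mem_erase, Finset.mem_erase]
    have ha := (hlK a).1 hl.head_mem
    have hc := (hlK c).1 hl.last_mem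
    refine ⟨[k] ++ l ++ [k'], ?_, ?_, fun v => ?_⟩
    · exact ((OrPath.single 0 k).append (hKK k a hk ha.2.2 ha.2.1.symm) (hl.orPath 0)).append
        (hKK c k' hc.2.2 hk' hc.1) (.single 0 k')
    · have hln := p.nodup_iff.2 (Finset.nodup_toList _)
      have h₁ := hlK k
      have h₂ := hlK k'
      simp [List.nodup_append, hln, hne]
      exact ⟨by tauto, fun a ha h => (h ▸ (hlK a).1 ha).1 rfl⟩
    · simp only [List.cons_append, List.nil_append, List.mem_cons, List.mem_append, hlK,
        List.not_mem_nil, or_false]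
      constructor
      · rintro (rfl | h | rfl)
        · exact hk
        · exact h.2.2
        · exact hk'
      · tauto

end Closing

/-! ### The partition into `K`, `Q`, `N` and its first consequences. -/

/-- A partition of the vertices into a clique `K`, a clique `Q` of vertices linked to all vertices
outside `K`, and a set `N`, as it arises from a vertex with the largest number `|K|` of
non-neighbours: every vertex of `N` has a neighbour in `K`, and if it has only one, then it has
only one non-neighbour in `N`. -/
structure Frame {V : Type*} (A : V → V → Prop) (K Q N : Finset V) : Prop where
  noIndep : NoIndepTriple A
  linkedK : LinkedOn A (· ∈ K)
  linkedQ : LinkedOn A (· ∈ Q)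
  linkedQN : ∀ a ∈ Q, ∀ b ∈ N, Linked A a b
  nonemptyQ : Q.Nonempty
  disjQN : ∀ v ∈ Q, v ∉ N
  mem_iff : ∀ v, v ∉ K ↔ v ∈ N ∨ v ∈ Q
  exists_linked : ∀ v ∈ N, ∃ k ∈ K, Linked A v k
  exists_not_linked : ∀ v ∈ N, ∃ z ∈ N, z ≠ v ∧ ¬ Linked A v z
  unique : ∀ v ∈ N, ∀ k ∈ K, (∀ κ ∈ K, Linked A v κ → κ = k) → ∀ z ∈ N, ∀ z' ∈ N, z ≠ v →
    z' ≠ v → ¬ Linked A v z → ¬ Linked A v z' → z = z'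

/-- The vertices have the same single neighbour in `K`, which has further vertices. -/
def SameSingle {V : Type*} (A : V → V → Prop) (K : Finset V) (a b : V) : Prop :=
  ∃ k ∈ K, (∃ κ ∈ K, κ ≠ k) ∧ ∀ κ ∈ K, (Linked A a κ → κ = k) ∧ (Linked A b κ → κ = k)

namespace Frame

variable {V : Type*} {A : V → V → Prop} {K Q N : Finset V}

theorem flip (F : Frame A K Q N) : Frame (flip A) K Q N where
  noIndep := F.noIndep.flip
  linkedK a b ha hb h := linked_flip.2 (F.linkedK a b ha hb h)
  linkedQ a b ha hb h := linked_flip.2 (F.linkedQ a b ha hb h)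
  linkedQN a ha b hb := linked_flip.2 (F.linkedQN a ha b hb)
  nonemptyQ := F.nonemptyQ
  disjQN := F.disjQN
  mem_iff := F.mem_iff
  exists_linked := by simpa only [linked_flip] using F.exists_linked
  exists_not_linked := by simpa only [linked_flip] using F.exists_not_linked
  unique := by simpa only [linked_flip] using F.unique

theorem _root_.SameSingle.symm {a b : V} (h : SameSingle A K a b) : SameSingle A K b a := by
  obtain ⟨k, hk, hκ, h⟩ := h
  exact ⟨k, hk, hκ, fun κ hκ => (h κ hκ).symm⟩

theorem nodup (F : Frame A K Q N) : (N.toList ++ Q.toList).Nodup := by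
  refine List.nodup_append.2 ⟨N.nodup_toList, Q.nodup_toList, ?_⟩
  rintro a ha b hb rfl
  exact F.disjQN a (Finset.mem_toList.1 hb) (Finset.mem_toList.1 ha)

theorem mem_perm_iff (F : Frame A K Q N) {M : List V} (p : M.Perm (N.toList ++ Q.toList)) (v : V) :
    v ∈ M ↔ v ∉ K := by
  rw [p.mem_iff, F.mem_iff]
  simp

theorem hasCycle_of_not_linked (F : Frame A K Q N) {M : List V} {s e : V}
    (hM : OrPath A 2 s e M) (p : M.Perm (N.toList ++ Q.toList)) (hs : s ∈ N) (he : e ∈ N)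
    (hse : s ≠ e) (hns : ¬ Linked A s e) : HasCycle A :=
  _root_.hasCycle_of_not_linked F.noIndep F.linkedK hM (p.nodup_iff.2 F.nodup) (F.mem_perm_iff p)
    hse hns (F.exists_linked s hs) (F.exists_linked e he)

/-- Unless `K` is a singleton, which is harmless, the only obstruction to distinct neighbours of the
two ends is that both have the same single one. -/
theorem hasCycle_of_not_sameSingle (F : Frame A K Q N) {M : List V} {s e : V}
    (hM : OrPath A 1 s e M) (p : M.Perm (N.toList ++ Q.toList)) (hs : s ∈ N) (he : e ∈ N)
    (hns : ¬ SameSingle A K s e) : HasCycle A := by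
  obtain ⟨k', hk', hsk⟩ := F.exists_linked s hs
  obtain ⟨k, hk, hek⟩ := F.exists_linked e he
  have close := fun {k k' : V} => hasCycle_of_ne (k := k) (k' := k') F.linkedK hM
    (p.nodup_iff.2 F.nodup) (F.mem_perm_iff p)
  by_cases hone : ∀ κ ∈ K, κ = k
  · exact close hk hk' hek hsk.symm (.inr hone)
  push Not at hone
  by_contra hC
  refine hns ⟨k, hk, hone, fun κ hκ => ⟨fun h => ?_, fun h => ?_⟩⟩
  · by_contra hne
    exact hC (close hk hκ hek h.symm (.inl (Ne.symm hne)))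
  · by_contra hne
    have : k' = k := by
      by_contra hne'
      exact hC (close hk hk' hek hsk.symm (.inl (Ne.symm hne')))
    subst this
    exact hC (close hκ hk' h hsk.symm (.inl hne))

theorem exists_dPath_Q (F : Frame A K Q N) : ∃ a c R, DPath A a c R ∧ R.Perm Q.toList := by
  obtain ⟨u, hu⟩ := F.nonemptyQ
  exact exists_dPath_of_linkedOn (List.ne_nil_of_mem (Finset.mem_toList.2 hu)) Q.nodup_toList
    (by simpa only [Finset.mem_toList] using F.linkedQ)

/-- The path `X`, a Rédei path of `Q`, then `Y` has two joints and unlinked ends. -/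
theorem hasCycle_of_ends_not_linked (F : Frame A K Q N) {x x' y y' : V} {X Y : List V}
    (hX : DPath A x x' X) (hY : DPath A y y' Y) (p : (X ++ Y).Perm N.toList)
    (h : ¬ Linked A y' x) : HasCycle A := by
  classical
  have hmem : ∀ v, v ∈ X ∨ v ∈ Y → v ∈ N := fun v hv =>
    Finset.mem_toList.1 (p.mem_iff.1 (List.mem_append.2 hv))
  obtain ⟨a, c, R, hR, pR⟩ := F.exists_dPath_Q
  have hRQ : ∀ v ∈ R, v ∈ Q := fun v hv => Finset.mem_toList.1 (pR.mem_iff.1 hv)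
  have hnd := List.nodup_append.1 (p.nodup_iff.2 N.nodup_toList)
  refine F.hasCycle_of_not_linked (M := X ++ R ++ Y)
    (((hX.orPath 0).append ?_ (hR.orPath 0)).append ?_ (hY.orPath 0)) ?_
    (hmem x (.inl hX.head_mem)) (hmem y' (.inr hY.last_mem)) ?_ (fun h' => h h'.symm)
  · exact (F.linkedQN a (hRQ a hR.head_mem) x' (hmem x' (.inl hX.last_mem))).symm
  · exact F.linkedQN c (hRQ c hR.last_mem) y (hmem y (.inr hY.head_mem))
  · rw [List.perm_iff_count] at p pR ⊢
    intro v
    have := p v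
    have := pR v
    simp only [List.count_append] at *
    omega
  · exact hnd.2.2 x hX.head_mem y' hY.last_mem

/-- Merging gives a path from `x` to `y'` or from `y` to `x'`, with no control over which; hence the
disjunction of the two obstructions. -/
theorem hasCycle_or_sameSingle (F : Frame A K Q N) {x x' y y' : V} {X Y : List V}
    (hX : DPath A x x' X) (hY : DPath A y y' Y) (p : (X ++ Y).Perm N.toList) :
    HasCycle A ∨ Linked A x' y ∧ Linked A y' x ∧
      (SameSingle A K y' x ∨ SameSingle A K x' y) := by
  classical
  by_cases h₁ : Linked A y' x
  swap
  · exact .inl (F.hasCycle_of_ends_not_linked hX hY p h₁)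
  by_cases h₂ : Linked A x' y
  swap
  · exact .inl (F.hasCycle_of_ends_not_linked hY hX (List.perm_append_comm.trans p) h₂)
  by_cases h₃ : SameSingle A K y' x
  · exact .inr ⟨h₂, h₁, .inl h₃⟩
  by_cases h₄ : SameSingle A K x' y
  · exact .inr ⟨h₂, h₁, .inr h₄⟩
  have hmem : ∀ v, v ∈ X ∨ v ∈ Y → v ∈ N := fun v hv =>
    Finset.mem_toList.1 (p.mem_iff.1 (List.mem_append.2 hv))
  have pQ := p.append_right Q.toList
  obtain ⟨l, pl, hl⟩ := hX.exists_orPath_one hY (pQ.nodup_iff.2 F.nodup)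
    (by simpa only [Finset.mem_toList] using F.linkedQ)
    (fun t ht v hv => F.linkedQN t (Finset.mem_toList.1 ht) v (hmem v (.inl hv)))
    (fun t ht v hv => F.linkedQN t (Finset.mem_toList.1 ht) v (hmem v (.inr hv))) h₂
  rcases hl with hl | hl
  · exact .inl (F.hasCycle_of_not_sameSingle hl (pl.trans pQ) (hmem x (.inl hX.head_mem))
      (hmem y' (.inr hY.last_mem)) (fun h => h₃ h.symm))
  · exact .inl (F.hasCycle_of_not_sameSingle hl (pl.trans pQ) (hmem y (.inr hY.head_mem))
      (hmem x' (.inl hX.last_mem)) (fun h => h₄ h.symm))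

/-- A vertex with a single neighbour in `K` has exactly one non-neighbour in `N`. -/
theorem exists_unique_not_linked (F : Frame A K Q N) {x k : V} (hx : x ∈ N) (hk : k ∈ K)
    (h : ∀ κ ∈ K, Linked A x κ → κ = k) :
    ∃ z ∈ N, z ≠ x ∧ ¬ Linked A x z ∧ (∀ v ∈ N, v ≠ x → v ≠ z → Linked A x v) ∧
      ∀ κ ∈ K, κ ≠ k → Linked A z κ := by
  obtain ⟨z, hz, hzx, hxz⟩ := F.exists_not_linked x hx
  refine ⟨z, hz, hzx, hxz, fun v hv hvx hvz => ?_, fun κ hκ hκk => ?_⟩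
  · by_contra hxv
    exact hvz (F.unique x hx k hk h v hv z hz hvx hzx hxv hxz)
  · have hxK := (F.mem_iff x).2 (.inl hx)
    have hzK := (F.mem_iff z).2 (.inl hz)
    rcases F.noIndep x z κ hzx.symm (by rintro rfl; exact hxK hκ) (by rintro rfl; exact hzK hκ)
      with h' | h' | h'
    · exact absurd h' hxz
    · exact absurd (h κ hκ h') hκk
    · exact h'

end Frame

/-! ### Recutting the paths when their ends share a single neighbour in `K`. -/

namespace Frame

variable {V : Type*} {A : V → V → Prop} {K Q N : Finset V}

theorem absorb (F : Frame A K Q N) {a c : V} {l : List V} (h : DPath A a c l)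
    (hl : ∀ v ∈ l, v ∈ N) : ∃ a' c' l', DPath A a' c' l' ∧ l'.Perm (Q.toList ++ l) ∧
      (a' = a ∨ a' ∈ Q) ∧ (c' = c ∨ c' ∈ Q) := by
  simpa only [Finset.mem_toList] using h.absorb Q.nodup_toList
    (by simpa only [Finset.mem_toList] using F.linkedQ)
    (fun t ht v hv => F.linkedQN t (Finset.mem_toList.1 ht) v (hl v hv))

/-- A vertex `x` cut out of a path of `N` forms a clique with `Q` and can be put back anywhere
together with it. As `Q` is nonempty, `x` is not both ends of the new path. -/
theorem exists_dPath_cons (F : Frame A K Q N) {x : V} (hx : x ∈ N) :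
    ∃ a c R, DPath A a c R ∧ R.Perm (x :: Q.toList) ∧ (a = x ∨ a ∈ Q) ∧ (c = x ∧ a ∈ Q ∨ c ∈ Q) := by
  have hxQ : x ∉ Q := fun h => F.disjQN x h hx
  have hnd : (x :: Q.toList).Nodup :=
    List.nodup_cons.2 ⟨by simpa using hxQ, Q.nodup_toList⟩
  obtain ⟨a, c, R, hR, p⟩ := exists_dPath_of_linkedOn (A := A) (List.cons_ne_nil x Q.toList) hnd (by
    intro a b ha hb hab
    simp only [List.mem_cons, Finset.mem_toList] at ha hb
    rcases ha with rfl | ha <;> rcases hb with rfl | hb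
    · exact absurd rfl hab
    · exact (F.linkedQN b hb a hx).symm
    · exact F.linkedQN a ha b hx
    · exact F.linkedQ a b ha hb hab)
  have hRm : ∀ v ∈ R, v = x ∨ v ∈ Q := fun v hv => by simpa using p.mem_iff.1 hv
  refine ⟨a, c, R, hR, p, hRm a hR.head_mem, ?_⟩
  rcases hRm c hR.last_mem with rfl | hc
  · refine .inl ⟨rfl, (hRm a hR.head_mem).resolve_left ?_⟩
    rintro rfl
    obtain ⟨t, rfl⟩ := hR.head
    rcases hR.tail with ⟨rfl, -⟩ | ⟨b, -, hb⟩
    · obtain ⟨u, hu⟩ := F.nonemptyQ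
      have := p.length_eq
      simp at this
      simp [this] at hu
    · exact (List.nodup_cons.1 (p.nodup_iff.2 hnd)).1 hb.last_mem
  · exact .inr hc

/-- If `N` has a Hamilton directed path whose ends have the same single neighbour in `K`, then the
non-neighbour of its start is used to build the cycle. -/
theorem hasCycle_of_dPath_of_sameSingle (F : Frame A K Q N) {x y : V} {L : List V}
    (h : DPath A x y L) (p : L.Perm N.toList) (hxy : Linked A y x) (hs : SameSingle A K y x) :
    HasCycle A := by
  classical
  have hmem : ∀ v, v ∈ L ↔ v ∈ N := fun v => by rw [p.mem_iff, Finset.mem_toList]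
  have hnd := p.nodup_iff.2 N.nodup_toList
  obtain ⟨k, hk, -, hs⟩ := hs
  have hx := (hmem x).1 h.head_mem
  have hy := (hmem y).1 h.last_mem
  obtain ⟨z, hz, hzx, hxz, hxN, -⟩ := F.exists_unique_not_linked hx hk (fun κ hκ => (hs κ hκ).2)
  obtain ⟨L', rfl⟩ := h.head
  have hzL : z ∈ L' := ((hmem z).2 hz |> List.mem_cons.1).resolve_left hzx
  rcases h.tail with ⟨rfl, -⟩ | ⟨w, hxw, hw⟩
  · simp at hzL
  obtain ⟨H₁, H₂, rfl⟩ := List.append_of_mem hzL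
  obtain ⟨hzy, h₁⟩ := hw.split
  rcases h₁ with ⟨rfl, rfl⟩ | ⟨b, hH₁, hbz⟩
  · exact absurd (Or.inl hxw) hxz
  rcases hzy.tail with ⟨rfl, rfl⟩ | ⟨b', hzb', hH₂⟩
  · exact absurd hxy.symm hxz
  have hm₁ : ∀ v ∈ H₁, v ∈ N ∧ v ≠ x ∧ v ≠ z ∧ v ∉ H₂ := by
    intro v hv
    refine ⟨(hmem v).1 (by simp [hv]), ?_, ?_, ?_⟩
    · rintro rfl; simp [hv] at hnd
    · rintro rfl; simp [List.nodup_append] at hnd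
      exact absurd rfl (hnd.2.2.2 v hv).1
    · intro hv'
      simp [List.nodup_append] at hnd
      exact (hnd.2.2.2 v hv).2 v hv' rfl
  have hm₂ : ∀ v ∈ H₂, v ∈ N ∧ v ≠ x ∧ v ≠ z := by
    intro v hv
    refine ⟨(hmem v).1 (by simp [hv]), ?_, ?_⟩
    · rintro rfl; simp [hv] at hnd
    · rintro rfl; simp [List.nodup_append, hv] at hnd
  have hw₁ := hm₁ w hH₁.head_mem
  have hb'₂ := hm₂ b' hH₂.head_mem
  -- The path is `x`, `H₁` (starting in `w`), `z`, `H₂` (ending in `y`). If `y` and `w` are linked,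
  -- `x`, then `H₂` with `Q` absorbed, then `H₁`, `z` has the unlinked ends `x` and `z`.
  by_cases hyw : Linked A y w
  · obtain ⟨a, c, P, hP, pP, ha, hc⟩ := F.absorb hH₂ (fun v hv => (hm₂ v hv).1)
    refine F.hasCycle_of_not_linked (M := [x] ++ P ++ (H₁ ++ [z]))
      (((OrPath.single 0 x).append ?_ (hP.orPath 0)).append ?_
        ((hH₁.append hbz (.single z)).orPath 0)) ?_ hx hz hzx.symm hxz
    · rcases ha with rfl | ha
      · exact hxN a hb'₂.1 hb'₂.2.1 hb'₂.2.2
      · exact (F.linkedQN a ha x hx).symm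
    · rcases hc with rfl | hc
      · exact hyw
      · exact F.linkedQN c hc w hw₁.1
    · rw [List.perm_iff_count] at p pP ⊢
      intro v
      have := p v
      have := pP v
      simp only [List.count_append, List.count_cons, List.count_nil] at *
      omega
  -- Otherwise `w` and `y` serve as unlinked ends, and `x` returns with `Q` next to `z`: behind `z`
  -- if `R` ends in `x`, before `z` if `R` ends in `Q`, so that `x` is never joined to `z`.
  · obtain ⟨a, c, R, hR, pR, ha, hc⟩ := F.exists_dPath_cons hx
    have hwy : w ≠ y := by
      rintro rfl
      exact hw₁.2.2.2 hH₂.last_mem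
    have hwy' : ¬ Linked A w y := fun h => hyw h.symm
    have haux : ∀ v ∈ N, v ≠ x → v ≠ z → Linked A v a := by
      intro v hv hvx hvz
      rcases ha with rfl | haQ
      · exact (hxN v hv hvx hvz).symm
      · exact (F.linkedQN a haQ v hv).symm
    rcases hc with ⟨rfl, haQ⟩ | hc
    · refine F.hasCycle_of_not_linked (M := (H₁ ++ [z]) ++ R ++ H₂)
        (((((hH₁.append hbz (.single z)).orPath 0)).append ?_ (hR.orPath 0)).append ?_
          (hH₂.orPath 0)) ?_ hw₁.1 hy hwy hwy'
      · exact (F.linkedQN a haQ z hz).symm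
      · exact hxN b' hb'₂.1 hb'₂.2.1 hb'₂.2.2
      · rw [List.perm_iff_count] at p pR ⊢
        intro v
        have := p v
        have := pR v
        simp only [List.count_append, List.count_cons, List.count_nil] at *
        omega
    · have hb₁ := hm₁ b hH₁.last_mem
      refine F.hasCycle_of_not_linked (M := H₁ ++ R ++ (z :: H₂))
        (((hH₁.orPath 0).append ?_ (hR.orPath 0)).append ?_
          (hzy.orPath 0)) ?_ hw₁.1 hy hwy hwy'
      · exact haux b hb₁.1 hb₁.2.1 hb₁.2.2.1
      · exact F.linkedQN c hc z hz
      · rw [List.perm_iff_count] at p pR ⊢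
        intro v
        have := p v
        have := pR v
        simp only [List.count_append, List.count_cons] at *
        omega

/-- Cutting the path at any arc yields a cover by two paths. Failing every time would force
consecutive vertices to share their single neighbour `k` in `K`, hence all of `N` to see only `k`.
But the non-neighbour of `x` in `N` is linked to all of `K` except possibly `k`. -/
theorem hasCycle_of_dPath (F : Frame A K Q N) {x y : V} {L : List V}
    (h : DPath A x y L) (p : L.Perm N.toList) : HasCycle A := by
  have hmem : ∀ v, v ∈ L ↔ v ∈ N := fun v => by rw [p.mem_iff, Finset.mem_toList]
  have hx := (hmem x).1 h.head_mem
  by_contra hC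
  have hend : ∀ {b b' : V} {l₁ l₂ : List V}, L = l₁ ++ l₂ → DPath A x b l₁ → DPath A b' y l₂ →
      Linked A y x ∧ SameSingle A K b b' := by
    rintro b b' l₁ l₂ rfl h₁ h₂
    obtain ⟨-, hyx, hs | hs⟩ := (F.hasCycle_or_sameSingle h₁ h₂ p).resolve_left hC
    · exact absurd (F.hasCycle_of_dPath_of_sameSingle h p hyx hs) hC
    · exact ⟨hyx, hs⟩
  obtain ⟨L', rfl⟩ := h.head
  obtain ⟨k, hk, ⟨κ, hκ, hκk⟩, hxk⟩ : ∃ k ∈ K, (∃ κ ∈ K, κ ≠ k) ∧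
      ∀ κ ∈ K, Linked A x κ → κ = k := by
    rcases h.tail with ⟨rfl, -⟩ | ⟨w, hxw, hw⟩
    · obtain ⟨z, hz, hzx, -⟩ := F.exists_not_linked x hx
      exact absurd (by simpa using (hmem z).2 hz) hzx
    · obtain ⟨-, k, hk, h, hs⟩ := hend (l₁ := [x]) rfl (.single x) hw
      exact ⟨k, hk, h, fun κ hκ => (hs κ hκ).1⟩
  obtain ⟨z, hz, hzx, hxz, -, hzκ⟩ := F.exists_unique_not_linked hx hk hxk
  rcases h.exists_split_or (P := fun v => ∀ κ ∈ K, Linked A v κ → κ = k) hxk with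
    hall | ⟨b, b', l₁, l₂, hl, h₁, h₂, hbb', hb, hb'⟩
  · exact hκk (hall z ((hmem z).2 hz) κ hκ (hzκ κ hκ hκk))
  · obtain ⟨-, k', hk', -, hs⟩ := hend hl h₁ h₂
    obtain ⟨κ', hκ', hbκ'⟩ := F.exists_linked b ((hmem b).1 (by rw [hl]; simp [h₁.last_mem]))
    obtain rfl := hb κ' hκ' hbκ'
    obtain rfl := (hs κ' hκ').1 hbκ'
    exact hb' (fun κ hκ => (hs κ hκ).2)

/-- In a cover of `N` by two directed paths of which the first one is as short as possible, the end
of the second and the start of the first path do not have the same single neighbour in `K`, unless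
there is a suitable cycle. -/
theorem hasCycle_of_minimal (F : Frame A K Q N) {x x' y y' : V} {X Y : List V}
    (hX : DPath A x x' X) (hY : DPath A y y' Y) (p : (X ++ Y).Perm N.toList)
    (hmin : ∀ {a a' b b' : V} {l m : List V}, DPath A a a' l → DPath A b b' m →
      (l ++ m).Perm N.toList → X.length ≤ l.length)
    (hxy : Linked A x' y) (hyx : Linked A y' x) (hs : SameSingle A K y' x) : HasCycle A := by
  classical
  by_contra hC
  have hmem : ∀ v, v ∈ X ∨ v ∈ Y ↔ v ∈ N := fun v => by
    rw [← List.mem_append, p.mem_iff, Finset.mem_toList]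
  have hnd := List.nodup_append.1 (p.nodup_iff.2 N.nodup_toList)
  obtain ⟨k, hk, -, hs⟩ := hs
  have hx := (hmem x).1 (.inl hX.head_mem)
  have hy' := (hmem y').1 (.inr hY.last_mem)
  obtain ⟨z, hz, hzx, hxz, hxN, -⟩ := F.exists_unique_not_linked hx hk (fun κ hκ => (hs κ hκ).2)
  have hxy' : A x y' := by
    refine hyx.resolve_left fun h => hC ?_
    exact F.hasCycle_of_dPath (hY.append h hX) (List.perm_append_comm.trans p)
  obtain ⟨X', rfl⟩ := hX.head
  have hxX' : x ∉ X' := (List.nodup_cons.1 hnd.1).1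
  have hxY : ∀ v ∈ Y, v ≠ x := fun v hv h => hnd.2.2 x (by simp) v hv h.symm
  -- A directed path on `x` and `Y` would move `x` over to `Y`, giving a shorter first path or a
  -- single path covering `N`.
  have hnoins : ∀ {a c : V} {m : List V}, DPath A a c m → m.Perm (x :: Y) → False := by
    intro a c m hm pm
    have pm' : (X' ++ m).Perm N.toList := by
      rw [List.perm_iff_count] at p pm ⊢
      intro v
      have := p v
      have := pm v
      simp only [List.count_append, List.count_cons] at *
      omega
    rcases hX.tail with ⟨rfl, -⟩ | ⟨b, -, hb⟩
    · exact hC (F.hasCycle_of_dPath hm pm')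
    · have := hmin hb hm pm'
      simp at this
  have hzY : z ∈ Y := by
    by_contra hzY
    obtain ⟨a, c, m, hm, pm, -⟩ := hY.insert (t := x) (fun v hv =>
      hxN v ((hmem v).1 (.inr hv)) (hxY v hv) (by rintro rfl; exact hzY hv))
    exact hnoins hm pm
  obtain ⟨Y₁, Y₂, rfl⟩ := List.append_of_mem hzY
  obtain ⟨hzy', hY₁⟩ := hY.split
  rcases hzy'.tail with ⟨rfl, rfl⟩ | ⟨b, hzb, hY₂⟩
  · exact absurd hyx.symm hxz
  have hzY₂ : z ∉ Y₂ := by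
    have := (List.nodup_append.1 hnd.2.1).2.1
    exact (List.nodup_cons.1 this).1
  have hlink₂ : ∀ v ∈ Y₂, Linked A x v := fun v hv =>
    hxN v ((hmem v).1 (.inr (by simp [hv]))) (hxY v (by simp [hv]))
      (by rintro rfl; exact hzY₂ hv)
  -- With the reverse arc, `x` could be inserted into `Y₂` behind its start `b`, leaving the arc
  -- from `z` to `b` intact; this contradicts `hnoins`.
  have hxb : A x b := by
    refine (hlink₂ b hY₂.head_mem).resolve_right fun hbx => ?_
    obtain ⟨d, m₁, m₂, rfl, h₁, hdx, h₂⟩ := hY₂.exists_insert hlink₂ ⟨b, hY₂.head_mem, hbx⟩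
    obtain ⟨c, hc⟩ : ∃ c, DPath A b c (m₁ ++ x :: m₂) := by
      rcases h₂ with ⟨rfl, -⟩ | ⟨b', h₂, h₃⟩
      · exact ⟨x, h₁.append hdx (.single x)⟩
      · exact ⟨y', h₁.append hdx (.cons h₂ h₃)⟩
    have hc' : DPath A z c (z :: (m₁ ++ x :: m₂)) := .cons hzb hc
    have pc : (Y₁ ++ z :: (m₁ ++ x :: m₂)).Perm (x :: (Y₁ ++ z :: (m₁ ++ m₂))) := by
      rw [List.perm_iff_count]
      intro v
      simp only [List.count_append, List.count_cons]
      omega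
    rcases hY₁ with ⟨rfl, rfl⟩ | ⟨e, hY₁, hez⟩
    · exact hnoins hc' pc
    · exact hnoins (hY₁.append hez hc') pc
  have hYz : DPath A y z (Y₁ ++ [z]) := by
    rcases hY₁ with ⟨rfl, rfl⟩ | ⟨e, hY₁, hez⟩
    · exact .single y
    · exact hY₁.append hez (.single z)
  have hyN := (hmem y).1 (.inr hY.head_mem)
  obtain hX' | ⟨x₂, hxx₂, hX'⟩ := hX.tail
  · obtain ⟨rfl, rfl⟩ := hX'
    obtain ⟨a, c, R, hR, pR⟩ := F.exists_dPath_Q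
    have hRQ : ∀ v ∈ R, v ∈ Q := fun v hv => Finset.mem_toList.1 (pR.mem_iff.1 hv)
    refine hC (F.hasCycle_of_not_linked (M := (x :: Y₂) ++ R ++ (Y₁ ++ [z]))
      (((DPath.cons hxb hY₂).orPath 0 |>.append ?_ (hR.orPath 0)).append ?_ (hYz.orPath 0)) ?_
      hx hz hzx.symm hxz)
    · exact (F.linkedQN a (hRQ a hR.head_mem) y' hy').symm
    · exact F.linkedQN c (hRQ c hR.last_mem) y hyN
    · rw [List.perm_iff_count] at p pR ⊢
      intro v
      have := p v
      have := pR v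
      simp only [List.count_append, List.count_cons, List.count_nil] at *
      omega
  have hX'N : ∀ v ∈ X', v ∈ N := fun v hv => (hmem v).1 (.inl (by simp [hv]))
  -- The path `x`, `Y₂`, then `X'` with `Q` absorbed, then `Y₁`, `z` has unlinked ends. Only the
  -- joint from `y'` to `X'` is in doubt.
  by_cases hyx₂ : Linked A y' x₂
  · obtain ⟨a, c, P, hP, pP, ha, hc⟩ := F.absorb hX' hX'N
    refine hC (F.hasCycle_of_not_linked (M := (x :: Y₂) ++ P ++ (Y₁ ++ [z]))
      (((DPath.cons hxb hY₂).orPath 0 |>.append ?_ (hP.orPath 0)).append ?_ (hYz.orPath 0)) ?_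
      hx hz hzx.symm hxz)
    · rcases ha with rfl | ha
      · exact hyx₂
      · exact (F.linkedQN a ha y' hy').symm
    · rcases hc with rfl | hc
      · exact hxy
      · exact F.linkedQN c hc y hyN
    · rw [List.perm_iff_count] at p pP ⊢
      intro v
      have := p v
      have := pP v
      simp only [List.count_append, List.count_cons, List.count_nil] at *
      omega
  -- If that joint fails, `x₂` and `y'` are themselves unlinked ends; `x` is returned with `Q` in
  -- `R`, between `X'` and `Y`.
  · obtain ⟨a, c, R, hR, pR, ha, hc⟩ := F.exists_dPath_cons hx
    have hx₂y : x₂ ≠ y' := hnd.2.2 x₂ (by simp [hX'.head_mem]) y' hY.last_mem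
    have hx₂y' : ¬ Linked A x₂ y' := fun h => hyx₂ h.symm
    have hx₂N := hX'N x₂ hX'.head_mem
    have hx'N := hX'N x' hX'.last_mem
    have hx'z : x' ≠ z := by
      rintro rfl
      exact hnd.2.2 x' (by simp [hX'.last_mem]) x' hzY rfl
    have hx'a : Linked A x' a := by
      rcases ha with rfl | ha
      · refine (hxN x' hx'N ?_ hx'z).symm
        rintro rfl
        exact hxX' hX'.last_mem
      · exact (F.linkedQN a ha x' hx'N).symm
    by_cases hcy : Linked A c y
    · refine hC (F.hasCycle_of_not_linked (M := X' ++ R ++ (Y₁ ++ z :: Y₂))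
        (((hX'.orPath 0).append hx'a (hR.orPath 0)).append hcy (hY.orPath 0)) ?_
        hx₂N hy' hx₂y hx₂y')
      rw [List.perm_iff_count] at p pR ⊢
      intro v
      have := p v
      have := pR v
      simp only [List.count_append, List.count_cons] at *
      omega
    -- `R` fails to reach `Y` only if it ends in `x` and `Y` starts with `z`. Then `z` is placed
    -- before `R`, and the arc from `x` to `b` leads on to `Y₂` for free.
    · obtain ⟨rfl, haQ⟩ := hc.resolve_right fun hc => hcy (F.linkedQN c hc y hyN)
      have hyz : y = z := by
        by_contra hyz
        exact hcy (hxN y hyN (hxY y hY.head_mem) hyz)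
      obtain rfl : Y₁ = [] := by
        rcases hY₁ with ⟨h, -⟩ | ⟨e, hY₁, -⟩
        · exact h
        · subst hyz
          exact absurd rfl ((List.nodup_append.1 hnd.2.1).2.2 y hY₁.head_mem y (by simp))
      subst hyz
      refine hC (F.hasCycle_of_not_linked (M := X' ++ [y] ++ (R ++ Y₂))
        (((hX'.orPath 0).append hxy (.single 0 y)).append ?_ ((hR.append hxb hY₂).orPath 0)) ?_
        hx₂N hy' hx₂y hx₂y')
      · exact (F.linkedQN a haQ y hyN).symm
      · rw [List.perm_iff_count] at p pR ⊢
        intro v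
        have := p v
        have := pR v
        simp only [List.count_append, List.count_cons, List.count_nil] at *
        omega

theorem hasCycle (F : Frame A K Q N) (hN : N.Nonempty) : HasCycle A := by
  classical
  rcases F.noIndep.exists_cover N.nodup_toList with h | ⟨a, c, l, h, p⟩ |
    ⟨a, b, c, l, d, m, h₁, h₂, p⟩
  · simp [hN.ne_empty] at h
  · exact F.hasCycle_of_dPath h p
  · have hex : ∃ n, ∃ x x' y y' X Y, DPath A x x' X ∧ DPath A y y' Y ∧ (X ++ Y).Perm N.toList ∧
        X.length = n := ⟨_, a, c, b, d, l, m, h₁, h₂, p, rfl⟩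
    obtain ⟨x, x', y, y', X, Y, hX, hY, p, hn⟩ := Nat.find_spec hex
    have hmin : ∀ {a a' b b' : V} {l m : List V}, DPath A a a' l → DPath A b b' m →
        (l ++ m).Perm N.toList → X.length ≤ l.length := by
      intro a a' b b' l m hl hm plm
      rw [hn]
      exact Nat.find_min' hex ⟨a, a', b, b', l, m, hl, hm, plm, rfl⟩
    rcases F.hasCycle_or_sameSingle hX hY p with h | ⟨hxy, hyx, hs | hs⟩
    · exact h
    · exact F.hasCycle_of_minimal hX hY p hmin hxy hyx hs
    · have hrev : ∀ {l m : List V}, (l ++ m).Perm N.toList →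
          (l.reverse ++ m.reverse).Perm N.toList := fun p =>
        (List.Perm.append (List.reverse_perm _) (List.reverse_perm _)).trans p
      -- Reversing all arcs exchanges starts and ends of the paths and so turns the second
      -- obstruction into the first; lengths, and hence minimality, are preserved.
      refine (F.flip.hasCycle_of_minimal hX.reverse hY.reverse (hrev p) ?_ hyx hxy ?_).of_flip
      · intro a a' b b' l m hl hm plm
        simpa using hmin hl.reverse hm.reverse (hrev plm)
      · obtain ⟨k, hk, h, hs⟩ := hs
        exact ⟨k, hk, h, fun κ hκ => by
          simpa only [linked_flip] using And.symm (hs κ hκ)⟩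

end Frame

/-! ### The extremal vertex and the partition it defines. -/

section Main

variable {V : Type*}

/-- The closing pair is charged one, turning the bound four into five. `P` needs only to vanish on
arcs, which suits counting backward arcs as well as the trivial predicate. -/
theorem OrPath.cyclic {A : V → V → Prop} {n : ℕ} {a b : V} {l : List V} (h : OrPath A n a b l)
    (P : V × V → Bool) (hP : ∀ e, A e.1 e.2 → P e = false) (x : V) (hx : Linked A b x) :
    (∀ e ∈ l.zip (l.tail ++ [x]), Linked A e.1 e.2) ∧
      (l.zip (l.tail ++ [x])).countP P ≤ n + 1 := by
  induction h with
  | single n a =>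
    refine ⟨by simpa using hx, ?_⟩
    exact (List.countP_le_length).trans (by simp)
  | @forward n a b c l hab h ih =>
    obtain ⟨m, rfl⟩ : ∃ m, l = b :: m := by cases h <;> exact ⟨_, rfl⟩
    obtain ⟨h₁, h₂⟩ := ih hx
    simp only [List.tail_cons, List.cons_append, List.zip_cons_cons, List.mem_cons,
      List.countP_cons, hP (a, b) hab, Bool.false_eq_true, if_false] at h₁ h₂ ⊢
    refine ⟨?_, h₂⟩
    rintro e (rfl | he)
    · exact .inl hab
    · exact h₁ e he
  | @backward n a b c l hab h ih =>
    obtain ⟨m, rfl⟩ : ∃ m, l = b :: m := by cases h <;> exact ⟨_, rfl⟩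
    obtain ⟨h₁, h₂⟩ := ih hx
    simp only [List.tail_cons, List.cons_append, List.zip_cons_cons, List.mem_cons,
      List.countP_cons] at h₁ h₂ ⊢
    refine ⟨?_, ?_⟩
    · rintro e (rfl | he)
      · exact .inr hab
      · exact h₁ e he
    · split_ifs <;> omega

/-- A vertex with the largest number of non-neighbours yields a cycle, if any two complementary
nonempty sets are joined by an arc even after the deletion of one vertex. -/
theorem hasCycle_of_crossing [Fintype V] {A : V → V → Prop}
    (hα : NoIndepTriple A) (hcard : 2 < Fintype.card V)
    (hcross : ∀ (U W : Finset V) (s : Option V), U.Nonempty → W.Nonempty → Disjoint U W →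
      (∀ v, v ∈ U ∨ v ∈ W ∨ s = some v) → ∃ u ∈ U, ∃ w ∈ W, Linked A u w) : HasCycle A := by
  classical
  let nb : V → Finset V := fun u => Finset.univ.filter fun v => v ≠ u ∧ ¬ Linked A u v
  have hnb : ∀ u v, v ∈ nb u ↔ v ≠ u ∧ ¬ Linked A u v := fun u v => by simp [nb]
  have hne : (Finset.univ : Finset V).Nonempty := by
    rw [Finset.univ_nonempty_iff, ← Fintype.card_pos_iff]; omega
  obtain ⟨u, -, hu⟩ := Finset.exists_max_image Finset.univ (fun u => (nb u).card) hne
  have hmax : ∀ v, (nb v).card ≤ (nb u).card := fun v => hu v (Finset.mem_univ v)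
  have hclique : ∀ v, LinkedOn A (· ∈ nb v) := by
    intro v a b ha hb hab
    rw [hnb] at ha hb
    rcases hα v a b ha.1.symm hb.1.symm hab with h | h | h
    · exact absurd h ha.2
    · exact absurd h hb.2
    · exact h
  rcases (nb u).eq_empty_or_nonempty with hK | hK
  -- Here any two vertices are linked, and a closed Rédei path suffices.
  · have hall : ∀ a b, a ≠ b → Linked A a b := by
      intro a b hab
      by_contra h
      have : b ∈ nb a := (hnb a b).2 ⟨hab.symm, h⟩
      have := hmax a
      simp only [hK, Finset.card_empty, Nat.le_zero, Finset.card_eq_zero] at this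
      simp_all
    obtain ⟨a, c, l, hl, p⟩ := exists_dPath_of_linkedOn (A := A)
      (T := (Finset.univ : Finset V).toList) (by simpa using hne.ne_empty)
      (Finset.nodup_toList _) (fun a b _ _ hab => hall a b hab)
    have hnd := p.nodup_iff.2 (Finset.nodup_toList _)
    refine ⟨a, c, l, hl.orPath 4, hall c a ?_, hnd, fun v => p.mem_iff.2 (by simp)⟩
    rintro rfl
    obtain ⟨t, rfl⟩ := hl.head
    rcases hl.tail with ⟨rfl, -⟩ | ⟨b, -, hb⟩
    · have := p.length_eq
      simp at this
      omega
    · exact (List.nodup_cons.1 hnd).1 hb.last_mem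
  set K := nb u with hKdef
  let Q : Finset V := Finset.univ.filter fun v => v ∉ K ∧ ∀ w, w ∉ K → w ≠ v → Linked A v w
  let N : Finset V := Finset.univ.filter fun v => v ∉ K ∧ v ∉ Q
  have hQ : ∀ v, v ∈ Q ↔ v ∉ K ∧ ∀ w, w ∉ K → w ≠ v → Linked A v w := fun v => by simp [Q]
  have hN : ∀ v, v ∈ N ↔ v ∉ K ∧ v ∉ Q := fun v => by simp [N]
  have huQ : u ∈ Q := by
    refine (hQ u).2 ⟨fun h => ((hnb u u).1 h).1 rfl, fun w hw hwu => ?_⟩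
    by_contra h
    exact hw ((hnb u w).2 ⟨hwu, h⟩)
  have hQQ : LinkedOn A (· ∈ Q) := fun a b ha hb hab =>
    ((hQ a).1 ha).2 b ((hQ b).1 hb).1 hab.symm
  rcases N.eq_empty_or_nonempty with hNe | hNn
  · have hKQ : ∀ v, v ∈ Q ↔ v ∉ K := by
      intro v
      have h₁ := hN v
      have h₂ := hQ v
      rw [hNe] at h₁
      simp only [Finset.notMem_empty, false_iff] at h₁
      tauto
    -- Two links with distinct ends in `Q`, and in `K` unless that is a singleton. Deleting `a`
    -- leaves `u` in `Q`, as `u` has no neighbour in `K`. If both links found end in `b`, deleting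
    -- `b` gives a third one, which pairs with one of the first two.
    obtain ⟨a, b, c, d, ha, hb, hc, hd, hac, hbd, hcd, hor⟩ : ∃ a b c d, a ∈ Q ∧ b ∈ K ∧ c ∈ Q ∧
        d ∈ K ∧ a ≠ c ∧ Linked A a b ∧ Linked A c d ∧ (b ≠ d ∨ ∀ κ ∈ K, κ = b) := by
      have hdisj : Disjoint Q K := Finset.disjoint_left.2 fun v h => (hKQ v).1 h
      obtain ⟨a, ha, b, hb, hab⟩ := hcross Q K none ⟨u, huQ⟩ hK hdisj (fun v => by
        have := hKQ v; tauto)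
      have hua : u ≠ a := by
        rintro rfl
        exact ((hnb u b).1 hb).2 hab
      obtain ⟨c, hc, d, hd, hcd⟩ := hcross (Q.erase a) K (some a)
        ⟨u, Finset.mem_erase.2 ⟨hua, huQ⟩⟩ hK (hdisj.mono_left (Finset.erase_subset _ _)) (fun v => by
          have := hKQ v
          simp only [Finset.mem_erase, Option.some.injEq]
          by_cases h : a = v <;> tauto)
      obtain ⟨hca, hcQ⟩ := Finset.mem_erase.1 hc
      by_cases hone : ∀ κ ∈ K, κ = b
      · exact ⟨a, b, c, d, ha, hb, hcQ, hd, hca.symm, hab, hcd, .inr hone⟩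
      by_cases hbd : b = d
      · subst hbd
        push Not at hone
        obtain ⟨κ, hκ, hκb⟩ := hone
        obtain ⟨e, he, f, hf, hef⟩ := hcross Q (K.erase b) (some b)
          ⟨u, huQ⟩ ⟨κ, Finset.mem_erase.2 ⟨hκb, hκ⟩⟩
          (hdisj.mono_right (Finset.erase_subset _ _)) (fun v => by
            have := hKQ v
            simp only [Finset.mem_erase, Option.some.injEq]
            by_cases h : b = v <;> tauto)
        obtain ⟨hfb, hf⟩ := Finset.mem_erase.1 hf
        by_cases hea : e = a
        · subst hea
          exact ⟨e, f, c, b, he, hf, hcQ, hb, hca.symm, hef, hcd, .inl hfb⟩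
        · exact ⟨e, f, a, b, he, hf, ha, hb, hea, hef, hab, .inl hfb⟩
      · exact ⟨a, b, c, d, ha, hb, hcQ, hd, hca.symm, hab, hcd, .inl hbd⟩
    have hT : ∀ v, v ∈ ((Q.erase a).erase c).toList ↔ v ≠ c ∧ v ≠ a ∧ v ∈ Q := fun v => by
      rw [Finset.mem_toList, Finset.mem_erase, Finset.mem_erase]
    have hnd : ([a] ++ [c] ++ ((Q.erase a).erase c).toList).Nodup := by
      have := Finset.nodup_toList ((Q.erase a).erase c)
      have h₁ := hT a
      have h₂ := hT c
      simp only [List.cons_append, List.nil_append, List.nodup_cons, List.mem_cons]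
      tauto
    obtain ⟨l, p, hl⟩ := (DPath.single (A := A) a).exists_orPath_one (DPath.single c) hnd
      (fun v w hv hw hvw => hQQ v w ((hT v).1 hv).2.2 ((hT w).1 hw).2.2 hvw)
      (fun t ht v hv => by
        obtain rfl := List.mem_singleton.1 hv
        exact hQQ t v ((hT t).1 ht).2.2 ha ((hT t).1 ht).2.1)
      (fun t ht v hv => by
        obtain rfl := List.mem_singleton.1 hv
        exact hQQ t v ((hT t).1 ht).2.2 hc ((hT t).1 ht).1)
      (hQQ a c ha hc hac)
    have hlK : ∀ v, v ∈ l ↔ v ∉ K := by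
      intro v
      rw [p.mem_iff, ← hKQ]
      simp only [List.mem_append, List.mem_singleton, hT]
      constructor
      · rintro ((rfl | rfl) | h)
        · exact ha
        · exact hc
        · exact h.2.2
      · tauto
    rcases hl with hl | hl
    · refine hasCycle_of_ne (hclique u) hl (p.nodup_iff.2 hnd) hlK hd hb hcd hbd.symm ?_
      rcases hor with h | h
      · exact .inl h.symm
      · exact .inr fun κ hκ => (h κ hκ).trans (h d hd).symm
    · exact hasCycle_of_ne (hclique u) hl (p.nodup_iff.2 hnd) hlK hb hd hbd hcd.symm hor
  · refine Frame.hasCycle (K := K) (Q := Q) (N := N) ?_ hNn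
    have hnl : ∀ v ∈ N, ∃ z ∈ N, z ≠ v ∧ ¬ Linked A v z := by
      intro v hv
      obtain ⟨hvK, hvQ⟩ := (hN v).1 hv
      have : ∃ z, z ∉ K ∧ z ≠ v ∧ ¬ Linked A v z := by
        by_contra h
        push Not at h
        exact hvQ ((hQ v).2 ⟨hvK, h⟩)
      obtain ⟨z, hzK, hzv, hvz⟩ := this
      exact ⟨z, (hN z).2 ⟨hzK, fun h => hvz (((hQ z).1 h).2 v hvK hzv.symm).symm⟩, hzv, hvz⟩
    have hle : ∀ v (S : Finset V), (∀ w ∈ S, w ≠ v ∧ ¬ Linked A v w) → S.card ≤ K.card :=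
      fun v S hS => (Finset.card_le_card fun w hw => (hnb v w).2 (hS w hw)).trans (hmax v)
    have hKN : ∀ v ∈ N, ∀ κ ∈ K, κ ≠ v := by
      rintro v hv κ hκ rfl
      exact ((hN κ).1 hv).1 hκ
    refine
      { noIndep := hα
        linkedK := hclique u
        linkedQ := hQQ
        linkedQN := fun a ha b hb => ((hQ a).1 ha).2 b ((hN b).1 hb).1 ?_
        nonemptyQ := ⟨u, huQ⟩
        disjQN := fun v hv h => ((hN v).1 h).2 hv
        mem_iff := fun v => ?_
        exists_linked := fun v hv => ?_
        exists_not_linked := hnl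
        unique := ?_ }
    · rintro rfl
      exact ((hN b).1 hb).2 ha
    · have h₁ := hN v
      have h₂ := hQ v
      tauto
    · by_contra h
      push Not at h
      obtain ⟨z, hz, hzv, hvz⟩ := hnl v hv
      have hzK := ((hN z).1 hz).1
      -- A vertex of `N` without neighbours in `K` would have more than `|K|` non-neighbours.
      have := hle v (insert z K) (by
        intro w hw
        rcases Finset.mem_insert.1 hw with rfl | hw
        · exact ⟨hzv, hvz⟩
        · exact ⟨hKN v hv w hw, h w hw⟩)
      rw [Finset.card_insert_of_notMem hzK] at this
      omega
    · intro v hv k hk h z hz z' hz' hzv hz'v hvz hvz'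
      by_contra hzz'
      have hzK := ((hN z).1 hz).1
      have hz'K := ((hN z').1 hz').1
      -- Losing `k` and gaining `z` and `z'` would again exceed the maximum `|K|`.
      have := hle v (insert z (insert z' (K.erase k))) (by
        intro w hw
        simp only [Finset.mem_insert, Finset.mem_erase] at hw
        rcases hw with rfl | rfl | hw
        · exact ⟨hzv, hvz⟩
        · exact ⟨hz'v, hvz'⟩
        · exact ⟨hKN v hv w hw.2, fun hl => hw.1 (h w hw.2 hl)⟩)
      rw [Finset.card_insert_of_notMem (by simp [hzz', hzK]),
        Finset.card_insert_of_notMem (by simp [hz'K]), Finset.card_erase_of_mem hk] at this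
      omega

end Main

/-! ### Translation to digraphs and the upper bound. -/

namespace Digraph

theorem linked_iff_adj {V : Type*} {D : Digraph V} (hD : D.IsLoopless) {a b : V} :
    D.toSimpleGraphInclusive.Adj a b ↔ Linked D.Adj a b := by
  rw [toSimpleGraphInclusive, SimpleGraph.fromRel_adj]
  refine ⟨fun h => h.2, fun h => ⟨?_, h⟩⟩
  rintro rfl
  exact hD a (h.elim id id)

theorem noIndepTriple_of_indepNum_le {V : Type*} [Finite V] {D : Digraph V}
    (h : D.indepNum ≤ 2) : NoIndepTriple D.Adj := by
  classical
  intro a b c hab hac hbc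
  by_contra hn
  have hind : D.toSimpleGraphInclusive.IsIndepSet (({a, b, c} : Finset V) : Set V) := by
    intro x hx y hy hxy hadj
    have hl : Linked D.Adj x y := (SimpleGraph.fromRel_adj _ _ _).1 hadj |>.2
    have hl' := hl.symm
    simp only [Finset.coe_insert, Finset.coe_singleton, Set.mem_insert_iff,
      Set.mem_singleton_iff] at hx hy
    rcases hx with rfl | rfl | rfl <;> rcases hy with rfl | rfl | rfl <;> tauto
  have := hind.card_le_indepNum
  rw [Finset.card_eq_three.2 ⟨a, b, c, hab, hac, hbc, rfl⟩] at this
  exact absurd (this.trans h) (by omega)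

/-- At most one vertex lies outside `U` and `W`; after its deletion, a walk from `U` to `W` has a
step that leaves `U`. -/
theorem IsKConnected.exists_linked {V : Type*} [Finite V] {D : Digraph V}
    (h : D.IsKConnected 2) {U W : Finset V} {s : Option V} (hU : U.Nonempty) (hW : W.Nonempty)
    (hUW : Disjoint U W) (hs : ∀ v, v ∈ U ∨ v ∈ W ∨ s = some v) :
    ∃ u ∈ U, ∃ w ∈ W, Linked D.Adj u w := by
  obtain ⟨u, hu⟩ := hU
  obtain ⟨w, hw⟩ := hW
  let S : Set V := {v | v ∉ U ∧ v ∉ W}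
  have hS : S.ncard < 2 := by
    refine lt_of_le_of_lt ((Set.ncard_le_one_iff).2 ?_) one_lt_two
    intro a b ha hb
    have h₁ := (hs a).resolve_left ha.1 |>.resolve_left ha.2
    have h₂ := (hs b).resolve_left hb.1 |>.resolve_left hb.2
    exact Option.some.inj (h₁.symm.trans h₂)
  obtain ⟨p⟩ := (h.2 S hS).preconnected ⟨u, fun h => h.1 hu⟩ ⟨w, fun h => h.2 hw⟩
  obtain ⟨d, -, h₁, h₂⟩ := p.exists_boundary_dart {v | v.1 ∈ U} hu
    (fun h => Finset.disjoint_left.1 hUW h hw)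
  refine ⟨d.fst.1, h₁, d.snd.1, ?_, ?_⟩
  · by_contra h₃
    exact d.snd.2 ⟨h₂, h₃⟩
  · have := d.adj
    rw [SimpleGraph.comap_adj] at this
    exact ((SimpleGraph.fromRel_adj _ _ _).1 this).2

theorem cyclicPairs_cons {V : Type*} (a : V) (l : List V) :
    cyclicPairs (a :: l) = (a :: l).zip (l ++ [a]) := by
  simp [cyclicPairs]

theorem exists_backwardArcs_le_five {V : Type*} [Finite V] (D : Digraph V)
    (hconn : D.IsKConnected 2) (hα : D.indepNum ≤ 2) :
    ∃ C : List V, D.IsHamiltonOrientedCycle C ∧ D.backwardArcs C ≤ 5 := by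
  classical
  have := Fintype.ofFinite V
  have hcard : 2 < Fintype.card V := by
    rw [← Nat.card_eq_fintype_card]
    exact hconn.1
  obtain ⟨a, b, L, hL, hba, hnd, hmem⟩ := hasCycle_of_crossing
    (noIndepTriple_of_indepNum_le hα) hcard
    (fun U W s hU hW hUW hs => hconn.exists_linked hU hW hUW hs)
  obtain ⟨l, rfl⟩ : ∃ l, L = a :: l := by cases hL <;> exact ⟨_, rfl⟩
  have hcyc := fun P hP => hL.cyclic P hP a hba
  simp only [List.tail_cons, ← cyclicPairs_cons] at hcyc
  refine ⟨a :: l, ⟨⟨hnd, ?_, (hcyc (fun _ => false) (fun _ _ => rfl)).1⟩, hmem⟩, ?_⟩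
  · have : (a :: l).toFinset = Finset.univ := by
      ext v
      simpa using hmem v
    rw [← List.toFinset_card_of_nodup hnd, this, Finset.card_univ]
    omega
  · exact (hcyc _ (fun e he => by simpa using he)).2

/-! ### The example with four backward arcs. -/

/-- Two transitive tournaments on `0 < 1 < 2 < 3` and `4 < 5 < 6 < 7`, joined by the arcs `04` and
`26`. -/
def arc (i j : Fin 8) : Bool :=
  (decide (i < j) && decide (i.val / 4 = j.val / 4)) || (i == 0 && j == 4) || (i == 2 && j == 6)

/-- The digraph with the arcs given by `arc`. -/
def twoTournaments : Digraph (Fin 8) := ⟨fun i j => arc i j = true⟩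

/-- Depth-first search: every oriented path of `n` further vertices that continues a path from
`first` to `cur` with `cost` backward arcs and avoids `visited` gives a cycle with at least four
backward arcs. -/
def search : ℕ → List (Fin 8) → Fin 8 → Fin 8 → ℕ → Bool
  | 0, _, first, cur, cost =>
    !(arc cur first || arc first cur) || decide (4 ≤ cost + (if arc cur first then 0 else 1))
  | n + 1, visited, first, cur, cost => (List.finRange 8).all fun x =>
    visited.contains x || !(arc cur x || arc x cur) ||
      search n (x :: visited) first x (cost + (if arc cur x then 0 else 1))

theorem search_sound {P : Fin 8 × Fin 8 → Bool} (hP : ∀ e, P e = !arc e.1 e.2) (l : List (Fin 8)) :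
    ∀ (visited : List (Fin 8)) (first cur : Fin 8) (cost : ℕ),
    search l.length visited first cur cost = true → l.Nodup → (∀ v ∈ l, v ∉ visited) →
    (∀ e ∈ (cur :: l).zip (l ++ [first]), arc e.1 e.2 = true ∨ arc e.2 e.1 = true) →
    4 ≤ cost + ((cur :: l).zip (l ++ [first])).countP P := by
  induction l with
  | nil =>
    intro visited first cur cost h _ _ hl
    simp only [List.length_nil, search, Bool.or_eq_true, Bool.not_eq_true', Bool.or_eq_false_iff,
      decide_eq_true_eq] at h
    have := hl (cur, first) (by simp)
    rcases h with h | h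
    · simp_all
    · simp only [List.nil_append, List.zip_cons_cons, List.zip_nil_left, List.countP_cons,
        List.countP_nil, hP]
      cases hc : arc cur first <;> simp_all
  | cons x l ih =>
    intro visited first cur cost h hnd hvis hl
    simp only [List.length_cons, search, List.all_eq_true, Bool.or_eq_true] at h
    have hx := hl (cur, x) (by simp)
    have hs := (h x (List.mem_finRange x)).resolve_left (by
      rintro (h' | h')
      · exact hvis x (by simp) (by simpa using h')
      · rcases hx with hx | hx <;> simp [hx] at h')
    have := ih _ _ _ _ hs hnd.of_cons (by
      intro v hv
      rw [List.mem_cons, not_or]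
      refine ⟨?_, hvis v (by simp [hv])⟩
      rintro rfl
      exact (List.nodup_cons.1 hnd).1 hv) (fun e he => hl e (by
        rw [List.cons_append, List.zip_cons_cons]
        exact List.mem_cons_of_mem _ he))
    rw [List.cons_append, List.zip_cons_cons, List.countP_cons, hP]
    cases hc : arc cur x <;> simp_all; omega

theorem twoTournaments_isLoopless : twoTournaments.IsLoopless := by
  intro v
  change ¬ arc v v = true
  revert v
  decide

theorem linked_twoTournaments {i j : Fin 8} :
    Linked twoTournaments.Adj i j ↔ (arc i j || arc j i) = true := by
  rw [Bool.or_eq_true]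
  exact Iff.rfl

theorem twoTournaments_indepNum_le : twoTournaments.indepNum ≤ 2 := by
  obtain ⟨S, hS⟩ := twoTournaments.toSimpleGraphInclusive.exists_isNIndepSet_indepNum
  by_contra h
  change ¬ twoTournaments.toSimpleGraphInclusive.indepNum ≤ 2 at h
  obtain ⟨a, ha, b, hb, c, hc, hab, hac, hbc⟩ := Finset.two_lt_card.1
    (show 2 < S.card by rw [hS.card_eq]; omega)
  have key : ∀ a b c : Fin 8, a ≠ b → a ≠ c → b ≠ c → (arc a b || arc b a) = true ∨
      (arc a c || arc c a) = true ∨ (arc b c || arc c b) = true := by decide +kernel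
  have hn : ∀ x ∈ S, ∀ y ∈ S, x ≠ y → ¬ (arc x y || arc y x) = true := by
    intro x hx y hy hxy hl
    exact hS.isIndepSet hx hy hxy
      ((linked_iff_adj twoTournaments_isLoopless).2 (linked_twoTournaments.2 hl))
  rcases key a b c hab hac hbc with h | h | h
  · exact hn a ha b hb hab h
  · exact hn a ha c hc hac h
  · exact hn b hb c hc hbc h

/-- The cross arcs 04 and 26 are disjoint, so one survives the deletion of a vertex, and every other
vertex is linked to one of its ends. -/
theorem twoTournaments_isKConnected : twoTournaments.IsKConnected 2 := by
  refine ⟨by simp, fun S hS => ?_⟩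
  have hsub : ∀ a ∈ S, ∀ b ∈ S, a = b := fun a ha b hb =>
    (Set.ncard_le_one_iff).1 (Nat.lt_succ_iff.1 hS) ha hb
  have hub : ∃ p q : Fin 8, p ∉ S ∧ q ∉ S ∧ (arc p q || arc q p) = true ∧
      ∀ x, x = p ∨ x = q ∨ (arc x p || arc p x) = true ∨ (arc x q || arc q x) = true := by
    by_cases h : (0 : Fin 8) ∉ S ∧ (4 : Fin 8) ∉ S
    · exact ⟨0, 4, h.1, h.2, by decide, by decide⟩
    · refine ⟨2, 6, ?_, ?_, by decide, by decide⟩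
      · intro h2
        have h₁ := fun h' => hsub 2 h2 0 h'
        have h₂ := fun h' => hsub 2 h2 4 h'
        simp at h₁ h₂
        tauto
      · intro h6
        have h₁ := fun h' => hsub 6 h6 0 h'
        have h₂ := fun h' => hsub 6 h6 4 h'
        simp at h₁ h₂
        tauto
  obtain ⟨p, q, hp, hq, hpq, hx⟩ := hub
  have hadj : ∀ {x y : Fin 8} (hx : x ∉ S) (hy : y ∉ S), (arc x y || arc y x) = true →
      (twoTournaments.toSimpleGraphInclusive.induce Sᶜ).Reachable ⟨x, hx⟩ ⟨y, hy⟩ := by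
    intro x y hx hy h
    refine SimpleGraph.Adj.reachable ?_
    rw [SimpleGraph.comap_adj]
    exact (linked_iff_adj twoTournaments_isLoopless).2 (linked_twoTournaments.2 h)
  refine SimpleGraph.connected_iff_exists_forall_reachable _ |>.2 ⟨⟨p, hp⟩, fun ⟨x, hxS⟩ => ?_⟩
  refine SimpleGraph.Reachable.symm ?_
  rcases hx x with rfl | rfl | h | h
  · rfl
  · exact (hadj hp hq hpq).symm
  · exact hadj hxS hp h
  · exact (hadj hxS hq h).trans (hadj hp hq hpq).symm

theorem four_le_backwardArcs_twoTournaments {C : List (Fin 8)}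
    (hC : twoTournaments.IsHamiltonOrientedCycle C) : 4 ≤ twoTournaments.backwardArcs C := by
  have hlen : C.length = 8 := by
    have : C.toFinset = Finset.univ := by
      ext v
      simpa using hC.mem v
    rw [← List.toFinset_card_of_nodup hC.nodup, this]
    simp
  obtain ⟨a, l, rfl⟩ := List.exists_cons_of_length_pos (l := C) (by omega)
  -- All starting vertices are checked, so the cycle need not be rotated to a fixed start.
  have hsearch : ∀ a : Fin 8, search 7 [a] a a 0 = true := by decide +kernel
  have hl : l.length = 7 := by simpa using hlen
  have hadj := hC.adj
  rw [cyclicPairs_cons] at hadj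
  rw [backwardArcs, cyclicPairs_cons]
  refine (search_sound (fun e => ?_) l [a] a a 0 (hl ▸ hsearch a) hC.nodup.of_cons ?_ hadj).trans
    (Nat.zero_add _).le
  · by_cases h : twoTournaments.Adj e.1 e.2
    · have h' : arc e.1 e.2 = true := h
      simp [h, h']
    · have h' : arc e.1 e.2 = false := Bool.eq_false_iff.2 h
      simp [h, h']
  · intro v hv hva
    obtain rfl := List.mem_singleton.1 hva
    exact (List.nodup_cons.1 hC.nodup).1 hv

end Digraph

theorem theorem1p3 :
    (∀ {V : Type*} [Finite V] (D : Digraph V), D.IsLoopless → D.IsKConnected 2 →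
      D.indepNum ≤ 2 →
      ∃ C : List V, D.IsHamiltonOrientedCycle C ∧ D.backwardArcs C ≤ 5) ∧
    (∃ (V : Type) (_ : Finite V) (D : Digraph V), D.IsLoopless ∧ D.IsKConnected 2 ∧
      D.indepNum ≤ 2 ∧
      ∀ C : List V, D.IsHamiltonOrientedCycle C → 4 ≤ D.backwardArcs C) := by
  refine ⟨fun D _ hconn hα => D.exists_backwardArcs_le_five hconn hα, ?_⟩
  exact ⟨Fin 8, inferInstance, Digraph.twoTournaments, Digraph.twoTournaments_isLoopless,
    Digraph.twoTournaments_isKConnected, Digraph.twoTournaments_indepNum_le,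
    fun C hC => Digraph.four_le_backwardArcs_twoTournaments hC⟩
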